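/- **Notation.** A *block* is a finite word $B$ of length $n$ in the letters $0,1$; let $P_B\subseteq\{1,\dots,n\}$ be the set of indices at which $B$ has a $1$. For a word of numbers, a *pinnacle* is a letter larger than both its neighbours (first and last letters are not pinnacles), and a *cyclic vale* is a letter that is smaller than both its neighbours after one letter $\infty$ has been inserted and the word has been wrapped around into a circle. For $i,j\ge 0$ let $p(B)^i_j$ be the number of arrangements of the multiset $\{1,\dots,n\}\cup\{0^j,(n+1)^i\}$ whose multiset of pinnacles is $P_B\cup\{(n+1)^i\}$ and in which all $j$ zeros are cyclic vales; put $p(B)=p(B)^0_0$. For $P\subseteq[n]=\{1,\dots,n\}$, not necessarily the pinnacle set of any permutation, let $p_n(P)$ be the set of $\pi\in S_n$ with pinnacle set $P$. Consider the following two rules for a family of rational numbers $F(B)^i_j$ (where $B$ runs over the blocks and $i,j\ge0$). (R) *Block recursion:* for all non-empty blocks $B_1,B_2$ and all $i,j\ge0$, with $b$ the number of ones in $B_2$, $$F(B_1B_2)^i_j=\sum_{a=1}^{b+i+1}F(B_1)^{a-1}_j\,F(B_2)^i_a .$$ (S) *Segregated-block formula:* for all $x,y,i,j\ge 0$ with $x+y\ge1$,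 with $c=i+y+1$ and $S(\cdot,\cdot)$ the Stirling numbers of the second kind (zero when the second argument is negative), $$F([0^x,1^y])^i_j=2^{x+j-c}\,\frac{c!\,(c-1)!}{i!}\sum_{m=0}^{\min(j,c)}\frac1{m!}\binom{c-m}{j-m}S(x,c-m).$$ **Theorem.** 1. The numbers $p(B)^i_j$ satisfy (R) and (S), and they are determined by these rules: if a family $F$ satisfies (R) and (S), then $F(A)^i_j=p(A)^i_j$ for every non-empty block $A$ and all $i,j\ge 0$. Moreover, for every $n\ge1$ and every $P\subseteq[n]$, the block $A$ of length $n$ with $P_A=P$ satisfies $p(A)=|p_n(P)|$. 2. There are one program and one constant $C$ such that, for every $n\ge1$ and every $P=\{p_1<\dots<p_k\}\subseteq[n]$, the program, given $n$, $k$ and the sorted list $p_1,\dots,p_k$, computes $p(A)=|p_n(P)|$ in at most $$C\,\bigl(K^2\log n+K^4\bigr),\qquad K=\max(k,1),$$ steps; for $k\ge1$ this is $O(k^2\log n+k^4)$. The program works on arrays of natural numbers (with addition, truncated subtraction, multiplication, halving, and comparisons that control branches and while loops) and on arrays of rational numbers (with the four field operations and no division by zero). Every arithmetic operation, constant, memory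 access, test and assignment counts as one step, so the bound holds in particular for the number of arithmetic operations. -/

import Mathlib

namespace Pinnacle

/-! ### Pinnacle sets of permutations -/

/-- The pinnacle set of `π ∈ S_n`. A permutation of `Fin n` is read as the word `π_1 ⋯ π_n` in
the letters `1, …, n`, so its letter at position `t` is `(π t : ℕ) + 1`. -/
def pinSet {n : ℕ} (π : Equiv.Perm (Fin n)) : Set ℕ :=
  {v | ∃ a b c : Fin n, (a : ℕ) + 1 = b ∧ (b : ℕ) + 1 = c ∧
    π a < π b ∧ π c < π b ∧ v = (π b : ℕ) + 1}

/-- `|p_n(P)|`: the number of permutations in `S_n` whose pinnacle set is `P`. -/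
noncomputable def pinnacleCount (n : ℕ) (P : Finset ℕ) : ℕ :=
  Nat.card {π : Equiv.Perm (Fin n) // pinSet π = (P : Set ℕ)}

/-! ### Blocks and the numbers `p(B)^i_j`

A block is an array of 0s (`false`) and 1s (`true`). -/

/-- The block of length `n` that represents `P ⊆ {1, …, n}`: entry `t` is 1 iff `t ∈ P`. -/
def block (n : ℕ) (P : Finset ℕ) : List Bool :=
  (List.range n).map fun t => decide (t + 1 ∈ P)

/-- `P_B`: the (1-based) indices at which `B` has a 1. -/
def ones (B : List Bool) : Finset ℕ :=
  (Finset.Icc 1 B.length).filter fun t => B[t - 1]? = some true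

/-- The multiset of pinnacles of a word: the letters at interior positions that are larger than
both neighbours. -/
def pinnacles {α : Type*} [LinearOrder α] : List α → Multiset α
  | a :: b :: c :: w =>
      if a < b ∧ c < b then b ::ₘ pinnacles (b :: c :: w) else pinnacles (b :: c :: w)
  | _ => 0

/-- The multiset of letters at interior positions that are smaller than both neighbours. -/
def vales {α : Type*} [LinearOrder α] : List α → Multiset α
  | a :: b :: c :: w =>
      if b < a ∧ b < c then b ::ₘ vales (b :: c :: w) else vales (b :: c :: w)
  | _ => 0

/-- The cyclic vales of a word: its vales after a single `∞` has been inserted and the word has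
been wrapped around into a circle, so that `∞` is a neighbour of both the first and the last
letter. -/
def cyclicVales (w : List ℕ) : Multiset (WithTop ℕ) :=
  vales (⊤ :: (w.map (fun a : ℕ => (a : WithTop ℕ)) ++ [⊤]))

/-- `P(B)^i_j`: the arrangements of the multiset `{1, …, n} ∪ {0^j, (n+1)^i}`, where `n` is the
length of `B`, with pinnacle multiset `P_B ∪ {(n+1)^i}` and all `j` zeros being cyclic vales. -/
def blockWords (B : List Bool) (i j : ℕ) : Set (List ℕ) :=
  {w | (w : Multiset ℕ) = (Finset.Icc 1 B.length).val
          + Multiset.replicate j 0 + Multiset.replicate i (B.length + 1) ∧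
       pinnacles w = (ones B).val + Multiset.replicate i (B.length + 1) ∧
       Multiset.replicate j (0 : WithTop ℕ) ≤ cyclicVales w}

/-- `p(B)^i_j`, the number of elements of `P(B)^i_j`. -/
noncomputable def blockCount (B : List Bool) (i j : ℕ) : ℕ :=
  (blockWords B i j).ncard

/-- The block recursion for a family of numbers `F B i j` (in the place of `p(B)^i_j`). -/
def BlockRecursion (F : List Bool → ℕ → ℕ → ℚ) : Prop :=
  ∀ B₁ B₂ : List Bool, B₁ ≠ [] → B₂ ≠ [] → ∀ i j : ℕ,
    F (B₁ ++ B₂) i j =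
      ∑ a ∈ Finset.Icc 1 (B₂.count true + i + 1), F B₁ (a - 1) j * F B₂ i a

/-- The right-hand side of the formula for the segregated block `[0^x, 1^y]`, with
`c = i + y + 1`. The sum is over `0 ≤ m ≤ j`; its terms with `m > c` vanish because they contain
a Stirling number `S(x, c - m)` with a negative second argument, so `m` stops at `min j c`. -/
def segregatedValue (x y i j : ℕ) : ℚ :=
  let c := i + y + 1
  (2 : ℚ) ^ ((x : ℤ) + j - c) * ((c.factorial * (c - 1).factorial : ℚ) / i.factorial) *
    ∑ m ∈ Finset.range (min j c + 1),
      1 / (m.factorial : ℚ) * (Nat.choose (c - m) (j - m) : ℚ) *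
        (Nat.stirlingSecond x (c - m) : ℚ)

/-- The segregated-block formula for a family of numbers `F B i j`: it gives the value at every
non-empty block `[0^x, 1^y]`. -/
def SegregatedFormula (F : List Bool → ℕ → ℕ → ℚ) : Prop :=
  ∀ x y i j : ℕ, 0 < x + y →
    F (List.replicate x false ++ List.replicate y true) i j = segregatedValue x y i j

/-! ### Arithmetic programs with a step count

A program works on arrays of natural numbers (indices, exponents, counters) and on arrays of
rational numbers. Arrays are named by natural numbers. On rational cells there are only the four
field operations; on natural cells there are addition, truncated subtraction, multiplication and
halving. The control flow is governed by comparisons of natural numbers. Every operation, every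
constant, every memory access, every test and every assignment costs one step. -/

/-- The memory: `nat a t` and `rat a t` are the cells number `t` of the arrays named `a`. -/
structure Memory where
  nat : ℕ → ℕ → ℕ
  rat : ℕ → ℕ → ℚ

/-- Expressions with natural values; `cell a e` is the cell of array `a` at the computed
address `e`. -/
inductive NatExpr where
  | const (c : ℕ)
  | cell (a : ℕ) (e : NatExpr)
  | add (e₁ e₂ : NatExpr)
  | sub (e₁ e₂ : NatExpr)
  | mul (e₁ e₂ : NatExpr)
  | half (e : NatExpr)

def NatExpr.eval (s : Memory) : NatExpr → ℕ
  | .const c => c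
  | .cell a e => s.nat a (e.eval s)
  | .add e₁ e₂ => e₁.eval s + e₂.eval s
  | .sub e₁ e₂ => e₁.eval s - e₂.eval s
  | .mul e₁ e₂ => e₁.eval s * e₂.eval s
  | .half e => e.eval s / 2

/-- The number of steps taken by the evaluation. -/
def NatExpr.cost : NatExpr → ℕ
  | .const _ => 1
  | .cell _ e => e.cost + 1
  | .add e₁ e₂ => e₁.cost + e₂.cost + 1
  | .sub e₁ e₂ => e₁.cost + e₂.cost + 1
  | .mul e₁ e₂ => e₁.cost + e₂.cost + 1
  | .half e => e.cost + 1

/-- Expressions with rational values. -/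
inductive RatExpr where
  | ofNat (e : NatExpr)
  | cell (a : ℕ) (e : NatExpr)
  | add (e₁ e₂ : RatExpr)
  | sub (e₁ e₂ : RatExpr)
  | mul (e₁ e₂ : RatExpr)
  | div (e₁ e₂ : RatExpr)

def RatExpr.eval (s : Memory) : RatExpr → ℚ
  | .ofNat e => (e.eval s : ℚ)
  | .cell a e => s.rat a (e.eval s)
  | .add e₁ e₂ => e₁.eval s + e₂.eval s
  | .sub e₁ e₂ => e₁.eval s - e₂.eval s
  | .mul e₁ e₂ => e₁.eval s * e₂.eval s
  | .div e₁ e₂ => e₁.eval s / e₂.eval s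

/-- The evaluation does not divide by zero. -/
def RatExpr.Defined (s : Memory) : RatExpr → Prop
  | .ofNat _ => True
  | .cell _ _ => True
  | .add e₁ e₂ => e₁.Defined s ∧ e₂.Defined s
  | .sub e₁ e₂ => e₁.Defined s ∧ e₂.Defined s
  | .mul e₁ e₂ => e₁.Defined s ∧ e₂.Defined s
  | .div e₁ e₂ => e₁.Defined s ∧ e₂.Defined s ∧ e₂.eval s ≠ 0

/-- The number of steps taken by the evaluation. -/
def RatExpr.cost : RatExpr → ℕ
  | .ofNat e => e.cost + 1
  | .cell _ e => e.cost + 1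
  | .add e₁ e₂ => e₁.cost + e₂.cost + 1
  | .sub e₁ e₂ => e₁.cost + e₂.cost + 1
  | .mul e₁ e₂ => e₁.cost + e₂.cost + 1
  | .div e₁ e₂ => e₁.cost + e₂.cost + 1

/-- Programs. `setNat a e v` and `setRat a e v` write the value of `v` into the cell of array `a`
at address `e`; `ifLt` and `whileLt` test whether `e₁ < e₂`. -/
inductive Program where
  | skip
  | setNat (a : ℕ) (e v : NatExpr)
  | setRat (a : ℕ) (e : NatExpr) (v : RatExpr)
  | seq (p q : Program)
  | ifLt (e₁ e₂ : NatExpr) (p q : Program)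
  | whileLt (e₁ e₂ : NatExpr) (p : Program)

def Memory.setNat (s : Memory) (a t v : ℕ) : Memory :=
  { s with nat := Function.update s.nat a (Function.update (s.nat a) t v) }

def Memory.setRat (s : Memory) (a t : ℕ) (v : ℚ) : Memory :=
  { s with rat := Function.update s.rat a (Function.update (s.rat a) t v) }

/-- `Runs p s s' t`: started in memory `s`, the program `p` halts in memory `s'` after exactly
`t` steps. A program that divides by zero is stuck and does not halt. -/
inductive Runs : Program → Memory → Memory → ℕ → Prop where
  | skip (s : Memory) : Runs .skip s s 1
  | setNat (a : ℕ) (e v : NatExpr) (s : Memory) :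
      Runs (.setNat a e v) s (s.setNat a (e.eval s) (v.eval s)) (e.cost + v.cost + 1)
  | setRat (a : ℕ) (e : NatExpr) (v : RatExpr) (s : Memory) (h : v.Defined s) :
      Runs (.setRat a e v) s (s.setRat a (e.eval s) (v.eval s)) (e.cost + v.cost + 1)
  | seq {p q : Program} {s₁ s₂ s₃ : Memory} {t₁ t₂ : ℕ}
      (h₁ : Runs p s₁ s₂ t₁) (h₂ : Runs q s₂ s₃ t₂) : Runs (.seq p q) s₁ s₃ (t₁ + t₂)
  | ifTrue {e₁ e₂ : NatExpr} {p q : Program} {s s' : Memory} {t : ℕ}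
      (h : e₁.eval s < e₂.eval s) (hp : Runs p s s' t) :
      Runs (.ifLt e₁ e₂ p q) s s' (e₁.cost + e₂.cost + 1 + t)
  | ifFalse {e₁ e₂ : NatExpr} {p q : Program} {s s' : Memory} {t : ℕ}
      (h : ¬ e₁.eval s < e₂.eval s) (hq : Runs q s s' t) :
      Runs (.ifLt e₁ e₂ p q) s s' (e₁.cost + e₂.cost + 1 + t)
  | whileTrue {e₁ e₂ : NatExpr} {p : Program} {s₁ s₂ s₃ : Memory} {t₁ t₂ : ℕ}
      (h : e₁.eval s₁ < e₂.eval s₁) (hp : Runs p s₁ s₂ t₁)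
      (hw : Runs (.whileLt e₁ e₂ p) s₂ s₃ t₂) :
      Runs (.whileLt e₁ e₂ p) s₁ s₃ (e₁.cost + e₂.cost + 1 + t₁ + t₂)
  | whileFalse {e₁ e₂ : NatExpr} {p : Program} {s : Memory}
      (h : ¬ e₁.eval s < e₂.eval s) :
      Runs (.whileLt e₁ e₂ p) s s (e₁.cost + e₂.cost + 1)

/-- The initial memory on input `(n, P)` with `P = {p_1 < ⋯ < p_k}`: natural array 0 holds `n`,
natural array 1 holds `k`, natural array 2 holds `p_1, …, p_k`, and all other cells are 0. -/
def input (n : ℕ) (P : Finset ℕ) : Memory where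
  nat := fun a t =>
    if a = 0 ∧ t = 0 then n
    else if a = 1 ∧ t = 0 then P.card
    else if a = 2 then (P.sort (· ≤ ·)).getD t 0
    else 0
  rat := fun _ _ => 0

/-- The result of a computation is found in cell 0 of rational array 0. -/
def Memory.output (s : Memory) : ℚ := s.rat 0 0

end Pinnacle

namespace Pinnacle

/-! ### Local structure of words -/

/-! A zero is the smallest possible letter, so it is a cyclic vale exactly when neither neighbour is
a zero. The condition on the zeros therefore says that no two of them are adjacent
(`mem_blockWords`).

Cut a word for the block $eB$ at its only letter 1 and lower the other positive letters by one. The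
1 is a pinnacle iff both its neighbours are zeros. If $e=1$, the factor $0\,1\,0$ is merged into one
marked zero of a word for $B$. If $e=0$, the 1 itself becomes a marked zero, after absorbing a zero
on its left, or on its right, or none. A word with $j$ zeros can be marked in $j$ ways, hence
$p(0B)^i_j=(j+1)\,p(B)^i_{j+1}+2j\,p(B)^i_j$ and $p(1B)^i_{j+1}=j\,p(B)^i_j$. On the polynomials
$\sum_j p(B)^i_jX^j$ the letters act as $(1+2X)\,d/dX$ and $X^2\,d/dX$, starting from $X^{i+1}$, or
$X+1$ when $i=0$ (`coeff_blockOp`).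

These operators are linear and kill constants. Expanding the polynomial of $B_2$ in powers of $X$
and applying the operator of $B_1$ to each power gives (R). Put $u=1+2X$. Then
$(1+2X)\,d/dX=2u\,d/du$, and $(u\,d/du)^x=\sum_d S(x,d)\,u^d(d/du)^d$ gives (S). Conversely, single
letters are segregated blocks, so peeling off first letters by (R) determines everything.

The algorithm keeps the coefficients in powers of $u$ for $i=0$. A run of $x$ zeros multiplies the
coefficient of $u^d$ by $(2d)^x$, and a one acts as $\frac12(u-1)^2\,d/du$, which is tridiagonal
(`exists_poly_blockVec`). The degree is at most $k+1$, and $p(A)$ is the value at $X=0$, that is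
$u=1$: the sum of the coefficients. Reading the block from the right takes $k$ rounds and a final
sum, each over $k+2$ coefficients with one fast exponentiation per coefficient, so $O(K^2(\log
n+1))$ steps suffice. -/

/-- No two adjacent letters are both zero. -/
def Spaced {α : Type*} [Zero α] (w : List α) : Prop :=
  w.IsChain fun a b => a ≠ 0 ∨ b ≠ 0

/-- Each zero of `m` contributes at most one vale, and it does so iff both its neighbours are
nonzero. The letter `x` is only a left neighbour, which lets the induction pass along the word; `x =
⊤` gives the cyclic vales. -/
theorem count_vales_le_and_eq_iff (m : List (WithTop ℕ)) (x : WithTop ℕ) :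
    (vales (x :: (m ++ [⊤]))).count 0 ≤ m.count 0 ∧
      ((vales (x :: (m ++ [⊤]))).count 0 = m.count 0 ↔ Spaced (x :: m)) := by
  induction m generalizing x with
  | nil => simp [vales, Spaced]
  | cons b m ih =>
    obtain ⟨ih₁, ih₂⟩ := ih b
    rcases m with _ | ⟨c, m⟩
    · by_cases hb : b = 0
      · subst hb
        by_cases hx : x = 0 <;> simp [vales, Spaced, hx, pos_iff_ne_zero]
      · by_cases hb' : b < x ∧ b < ⊤ <;> simp [vales, Spaced, hb, hb', Ne.symm hb]
    · have e : vales (x :: (b :: c :: m ++ [⊤])) =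
          if b < x ∧ b < c then b ::ₘ vales (b :: (c :: m ++ [⊤]))
            else vales (b :: (c :: m ++ [⊤])) := rfl
      have e' : Spaced (x :: b :: c :: m) ↔ (x ≠ 0 ∨ b ≠ 0) ∧ Spaced (b :: c :: m) := by
        simp [Spaced]
      have e'' : Spaced (b :: c :: m) → (b ≠ 0 ∨ c ≠ 0) := by
        simp +contextual [Spaced]
      rw [e, e', List.count_cons]
      by_cases hb : b = 0
      · subst hb
        by_cases h : (0 : WithTop ℕ) < x ∧ (0 : WithTop ℕ) < c
        · rw [if_pos h]
          simp only [Multiset.count_cons_self, beq_self_eq_true, if_true, add_left_inj, ih₂,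
            add_le_add_iff_right, ih₁, true_and]
          simp [h.1.ne']
        · rw [if_neg h]
          simp only [beq_self_eq_true, if_true]
          refine ⟨by omega, ⟨fun h' => by omega, fun h' => ?_⟩⟩
          refine absurd ?_ h
          have := e'' h'.2
          simp only [pos_iff_ne_zero]
          tauto
      · have : Multiset.count 0 (if b < x ∧ b < c then b ::ₘ vales (b :: (c :: m ++ [⊤]))
            else vales (b :: (c :: m ++ [⊤]))) = (vales (b :: (c :: m ++ [⊤]))).count 0 := by
          split_ifs
          · rw [Multiset.count_cons_of_ne (Ne.symm hb)]
          · rfl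
        rw [this]
        simpa [hb] using ih b

theorem replicate_zero_le_cyclicVales_iff (w : List ℕ) :
    Multiset.replicate (w.count 0) (0 : WithTop ℕ) ≤ cyclicVales w ↔ Spaced w := by
  have hc : (w.map (fun a : ℕ => (a : WithTop ℕ))).count 0 = w.count 0 :=
    List.count_map_of_injective w _ WithTop.coe_injective 0
  have h := count_vales_le_and_eq_iff (w.map (fun a : ℕ => (a : WithTop ℕ))) ⊤
  rw [hc] at h
  have hs : Spaced (⊤ :: w.map (fun a : ℕ => (a : WithTop ℕ))) ↔ Spaced w := by
    rcases w with _ | ⟨a, w⟩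
    · simp [Spaced]
    · rw [Spaced, List.map_cons, List.isChain_cons_cons, ← List.map_cons (l := w), List.isChain_map]
      simp [Spaced]
  rw [← Multiset.le_count_iff_replicate_le, ← hs, ← h.2, cyclicVales]
  exact ⟨fun h' => le_antisymm h.1 h', fun h' => h'.ge⟩

/-- Whether a letter other than `x` is a pinnacle is already visible in the half that contains it.
Only `x`, an end letter of both halves, needs the separate test `q`. -/
theorem pinnacles_append_cons {α : Type*} [LinearOrder α] (u v : List α) (x : α) (q : Prop)
    [Decidable q] (hq : q ↔ (∃ a, u.getLast? = some a ∧ a < x) ∧ ∃ c, v.head? = some c ∧ c < x) :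
    pinnacles (u ++ x :: v) =
      (if q then {x} else 0) + (pinnacles (u ++ [x]) + pinnacles (x :: v)) := by
  induction u with
  | nil => simp [hq, pinnacles]
  | cons a u ih =>
    rcases u with _ | ⟨b, u⟩
    · rcases v with _ | ⟨c, v⟩
      · simp [hq, pinnacles]
      · simp only [List.getLast?_singleton, List.head?_cons, Option.some.injEq,
          exists_eq_left'] at hq
        simp only [List.cons_append, List.nil_append, pinnacles, zero_add, ← hq]
        split_ifs <;> simp
    · have ih := ih (by simpa using hq)
      rcases u with _ | ⟨c, u⟩
      · simp only [List.cons_append, List.nil_append, pinnacles] at ih ⊢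
        simp only [ih]
        split_ifs <;> simp [← Multiset.singleton_add] <;> abel
      · simp only [List.cons_append] at ih ⊢
        rw [pinnacles, ih]
        conv_rhs => rw [pinnacles]
        split_ifs <;> simp [← Multiset.singleton_add] <;> abel

theorem pinnacles_append_zero_cons (u v : List ℕ) :
    pinnacles (u ++ 0 :: v) = pinnacles (u ++ [0]) + pinnacles (0 :: v) := by
  rw [pinnacles_append_cons u v 0 False (by simp)]
  simp

/-- The letters of a word after the insertion of a new smallest positive letter. -/
def shift (a : ℕ) : ℕ := if a = 0 then 0 else a + 1

theorem shift_ne_one (a : ℕ) : shift a ≠ 1 := by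
  unfold shift
  split_ifs <;> omega

theorem shift_strictMono : StrictMono shift := by
  intro a b h
  unfold shift
  split_ifs <;> omega

theorem pinnacles_map {α β : Type*} [LinearOrder α] [LinearOrder β] {f : α → β}
    (hf : StrictMono f) : ∀ w : List α, pinnacles (w.map f) = (pinnacles w).map f
  | [] => rfl
  | [_] => rfl
  | [_, _] => rfl
  | a :: b :: c :: w => by
    have ih := pinnacles_map hf (b :: c :: w)
    simp only [List.map_cons] at ih ⊢
    simp only [pinnacles, hf.lt_iff_lt, ih]
    split_ifs <;> simp

/-- The end letter matters only through its comparison with the letter before it, and `1 < shift b`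
holds iff `0 < b`. Thus the letter 1 can be traded for a zero at the cut. -/
theorem pinnacles_map_shift_append_one (u : List ℕ) :
    pinnacles (u.map shift ++ [1]) = (pinnacles (u ++ [0])).map shift := by
  rw [← pinnacles_map shift_strictMono]
  induction u with
  | nil => rfl
  | cons a u ih =>
    rcases u with _ | ⟨b, u⟩
    · rfl
    · rcases u with _ | ⟨c, u⟩
      · have : (shift a < shift b ∧ 1 < shift b) ↔ (shift a < shift b ∧ shift 0 < shift b) := by
          unfold shift; split_ifs <;> omega
        simp [pinnacles, this]
      · simp only [List.map_cons, List.cons_append] at ih ⊢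
        simp only [pinnacles] at ih ⊢
        rw [ih]

theorem pinnacles_one_cons_map_shift (v : List ℕ) :
    pinnacles (1 :: v.map shift) = (pinnacles (0 :: v)).map shift := by
  rw [← pinnacles_map shift_strictMono]
  rcases v with _ | ⟨b, _ | ⟨c, v⟩⟩
  · rfl
  · rfl
  · have : (1 < shift b ∧ shift c < shift b) ↔ (shift 0 < shift b ∧ shift c < shift b) := by
      unfold shift; split_ifs <;> omega
    simp [pinnacles, this]

/-- Among shifted letters only 0 lies below 1, so the 1 at the cut is a pinnacle iff it stands
between two zeros. -/
theorem pinnacles_map_shift_append_one_cons (u v : List ℕ) :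
    pinnacles (u.map shift ++ 1 :: v.map shift) =
      (if u.getLast? = some 0 ∧ v.head? = some 0 then {1} else 0) +
        (pinnacles (u ++ [0]) + pinnacles (0 :: v)).map shift := by
  have h : ∀ a, shift a < 1 ↔ a = 0 := by
    intro a; unfold shift; split_ifs <;> omega
  rw [pinnacles_append_cons _ _ 1 (u.getLast? = some 0 ∧ v.head? = some 0),
    pinnacles_map_shift_append_one, pinnacles_one_cons_map_shift, Multiset.map_add]
  simp only [List.getLast?_map, List.head?_map, Option.map_eq_some_iff]
  constructor
  · rintro ⟨h₁, h₂⟩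
    exact ⟨⟨_, ⟨0, h₁, rfl⟩, by decide⟩, _, ⟨0, h₂, rfl⟩, by decide⟩
  · rintro ⟨⟨_, ⟨a, h₁, rfl⟩, ha⟩, _, ⟨c, h₂, rfl⟩, hc⟩
    rw [(h a).1 ha] at h₁
    rw [(h c).1 hc] at h₂
    exact ⟨h₁, h₂⟩

/-! ### Recursions for the numbers `p(B)^i_j` -/

/-- The multiset of letters of a word in `P(B)^i_j`, for a block `B` of length `n`. -/
def letters (n i j : ℕ) : Multiset ℕ :=
  (Finset.Icc 1 n).val + Multiset.replicate j 0 + Multiset.replicate i (n + 1)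

/-- The multiset of pinnacles of a word in `P(B)^i_j`. -/
def tops (B : List Bool) (i : ℕ) : Multiset ℕ :=
  (ones B).val + Multiset.replicate i (B.length + 1)

theorem count_zero_letters (n i j : ℕ) : (letters n i j).count 0 = j := by
  simp [letters, Multiset.count_replicate]

theorem letters_succ_right (n i j : ℕ) : letters n i (j + 1) = 0 ::ₘ letters n i j := by
  simp [letters, Multiset.replicate_succ]

theorem map_shift_replicate_succ (i a : ℕ) :
    (Multiset.replicate i (a + 1)).map shift = Multiset.replicate i (a + 1 + 1) := by
  simp [shift]

theorem val_Icc_succ (n : ℕ) :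
    (Finset.Icc 1 (n + 1)).val = 1 ::ₘ (Finset.Icc 1 n).val.map shift := by
  have h1 : (1 : ℕ) ∉ (Finset.Icc 1 n).val.map shift := by
    simp only [Multiset.mem_map, not_exists, not_and]
    exact fun a _ => shift_ne_one a
  refine (Multiset.Nodup.ext (Finset.nodup _) (Multiset.nodup_cons.2
    ⟨h1, (Finset.nodup _).map shift_strictMono.injective⟩)).2 fun a => ?_
  simp only [Finset.mem_val, Finset.mem_Icc, Multiset.mem_cons, Multiset.mem_map]
  constructor
  · rintro ⟨h, h'⟩
    rcases h.eq_or_lt with rfl | h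
    · exact Or.inl rfl
    · exact Or.inr ⟨a - 1, by omega, by unfold shift; split_ifs <;> omega⟩
  · rintro (rfl | ⟨b, hb, rfl⟩)
    · omega
    · unfold shift; split_ifs <;> omega

theorem letters_succ (n i j : ℕ) :
    letters (n + 1) i j = 1 ::ₘ (letters n i j).map shift := by
  rw [letters, letters, Multiset.map_add, Multiset.map_add, map_shift_replicate_succ, val_Icc_succ]
  simp [shift]

theorem mem_ones {B : List Bool} {t : ℕ} :
    t ∈ ones B ↔ 1 ≤ t ∧ t ≤ B.length ∧ B[t - 1]? = some true := by
  simp [ones, and_assoc]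

theorem val_ones_cons (e : Bool) (B : List Bool) :
    (ones (e :: B)).val = (if e then {1} else 0) + (ones B).val.map shift := by
  have h1 : (1 : ℕ) ∉ (ones B).val.map shift := by
    simp only [Multiset.mem_map, not_exists, not_and]
    exact fun a _ => shift_ne_one a
  have hn : ((ones B).val.map shift).Nodup :=
    (Finset.nodup _).map shift_strictMono.injective
  have key : ∀ a, a ∈ ones (e :: B) ↔ (a = 1 ∧ e = true) ∨ a ∈ (ones B).val.map shift := by
    intro a
    simp only [mem_ones, Multiset.mem_map, Finset.mem_val, List.length_cons]
    constructor
    · rintro ⟨h, h', h''⟩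
      rcases h.eq_or_lt with rfl | h
      · left; simpa using h''
      · right
        obtain ⟨b, rfl⟩ : ∃ b, a = b + 2 := ⟨a - 2, by omega⟩
        exact ⟨b + 1, ⟨by omega, by omega, by simpa using h''⟩, by simp [shift]⟩
    · rintro (⟨rfl, rfl⟩ | ⟨b, ⟨hb, hb', hb''⟩, rfl⟩)
      · simp
      · obtain ⟨b, rfl⟩ : ∃ c, b = c + 1 := ⟨b - 1, by omega⟩
        exact ⟨by simp [shift], by simp [shift]; omega, by simpa [shift] using hb''⟩
  cases e
  · simp only [Bool.false_eq_true, if_false, zero_add]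
    exact (Multiset.Nodup.ext (Finset.nodup _) hn).2 fun a => by simpa using key a
  · simp only [if_true, Multiset.singleton_add]
    exact (Multiset.Nodup.ext (Finset.nodup _) (Multiset.nodup_cons.2 ⟨h1, hn⟩)).2
      fun a => by simpa using key a

theorem tops_cons (e : Bool) (B : List Bool) (i : ℕ) :
    tops (e :: B) i = (if e then {1} else 0) + (tops B i).map shift := by
  rw [tops, tops, Multiset.map_add, map_shift_replicate_succ, val_ones_cons, add_assoc]
  rfl

/-- The word contains exactly `j` zeros, so asking for `j` zeros among the cyclic vales asks this of
every zero. -/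
theorem mem_blockWords {B : List Bool} {i j : ℕ} {w : List ℕ} :
    w ∈ blockWords B i j ↔
      (w : Multiset ℕ) = letters B.length i j ∧ pinnacles w = tops B i ∧ Spaced w := by
  rw [blockWords, Set.mem_ofPred_eq]
  refine and_congr_right fun h => and_congr_right fun _ => ?_
  rw [← replicate_zero_le_cyclicVales_iff, ← Multiset.coe_count, h]
  exact iff_of_eq (congrArg (fun a => Multiset.replicate a (0 : WithTop ℕ) ≤ cyclicVales w)
    (count_zero_letters B.length i j).symm)

theorem finite_blockWords (B : List Bool) (i j : ℕ) : (blockWords B i j).Finite := by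
  refine (List.finite_toSet ((letters B.length i j).toList.permutations)).subset fun w hw => ?_
  rw [Set.mem_ofPred_eq, List.mem_permutations, ← Multiset.coe_eq_coe, Multiset.coe_toList]
  exact (mem_blockWords.1 hw).1

theorem ncard_splits {α : Type*} [DecidableEq α] (a : α) (w : List α) :
    {p : List α × List α | p.1 ++ a :: p.2 = w}.Finite ∧
      {p : List α × List α | p.1 ++ a :: p.2 = w}.ncard = w.count a := by
  induction w with
  | nil => simp
  | cons b w ih =>
    have hi : Function.Injective fun p : List α × List α => (b :: p.1, p.2) := by
      rintro ⟨u, v⟩ ⟨u', v'⟩ h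
      simpa using h
    have e : {p : List α × List α | p.1 ++ a :: p.2 = b :: w} =
        (if b = a then {([], w)} else ∅) ∪
          (fun p : List α × List α => (b :: p.1, p.2)) ''
            {p : List α × List α | p.1 ++ a :: p.2 = w} := by
      ext ⟨u, v⟩
      rcases u with _ | ⟨c, u⟩
      · split_ifs with h <;> simp [h, eq_comm]
        exact fun h' => absurd h'.symm h
      · split_ifs with h <;> simp [eq_comm, and_comm, and_left_comm]
    rw [e]
    have hf := ih.1.image fun p : List α × List α => (b :: p.1, p.2)
    split_ifs with h
    · refine ⟨(Set.finite_singleton _).union hf, ?_⟩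
      rw [Set.ncard_union_eq _ (Set.finite_singleton _) hf, Set.ncard_image_of_injective _ hi, ih.2]
      · simp [h, add_comm]
      · simp
    · rw [Set.empty_union]
      exact ⟨hf, by rw [Set.ncard_image_of_injective _ hi, ih.2, List.count_cons_of_ne h]⟩

/-- The words in `P(B)^i_j` with a marked zero. -/
def markedWords (B : List Bool) (i j : ℕ) : Set (List ℕ × List ℕ) :=
  {p | p.1 ++ 0 :: p.2 ∈ blockWords B i j}

theorem markedWords_eq_biUnion (B : List Bool) (i j : ℕ) :
    markedWords B i j =
      ⋃ w ∈ (finite_blockWords B i j).toFinset, {p : List ℕ × List ℕ | p.1 ++ 0 :: p.2 = w} := by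
  ext p; simp [markedWords]

theorem finite_markedWords (B : List Bool) (i j : ℕ) : (markedWords B i j).Finite := by
  rw [markedWords_eq_biUnion]
  exact Set.Finite.biUnion (Finset.finite_toSet _) fun w _ => (ncard_splits 0 w).1

/-- The marked words are fibred over the words, and each fibre consists of the `j` positions of a
zero. -/
theorem ncard_markedWords (B : List Bool) (i j : ℕ) :
    (markedWords B i j).ncard = j * blockCount B i j := by
  have h : (markedWords B i j).ncard = ∑ w ∈ (finite_blockWords B i j).toFinset,
      {p : List ℕ × List ℕ | p.1 ++ 0 :: p.2 = w}.ncard := by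
    rw [markedWords_eq_biUnion, ← finsum_mem_coe_finset,
      ← Set.Finite.ncard_biUnion (Finset.finite_toSet _) (fun w _ => (ncard_splits 0 w).1)]
    · rfl
    · intro w _ w' _ hw
      exact Set.disjoint_left.2 fun p h h' => hw (h.symm.trans h')
  rw [h, Finset.sum_congr rfl (g := fun _ => j), Finset.sum_const, smul_eq_mul, mul_comm,
    blockCount, Set.ncard_eq_toFinset_card _ (finite_blockWords B i j)]
  intro w hw
  rw [(ncard_splits 0 w).2, ← Multiset.coe_count,
    (mem_blockWords.1 ((Set.Finite.mem_toFinset _).1 hw)).1, count_zero_letters]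

theorem spaced_append_zero_cons {u v : List ℕ} :
    Spaced (u ++ 0 :: v) ↔
      (Spaced u ∧ Spaced v) ∧ u.getLast? ≠ some 0 ∧ v.head? ≠ some 0 := by
  rw [Spaced, List.isChain_append, List.isChain_cons]
  simp only [Spaced, List.head?_cons, Option.mem_def, Option.some.injEq, ne_eq]
  constructor
  · rintro ⟨h₁, ⟨h₂, h₃⟩, h₄⟩
    exact ⟨⟨h₁, h₃⟩, fun h => by simpa using h₄ 0 h 0 rfl, fun h => by simpa using h₂ 0 h⟩
  · rintro ⟨⟨h₁, h₃⟩, h₄, h₂⟩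
    refine ⟨h₁, ⟨fun y hy => Or.inr ?_, h₃⟩, fun x hx y _ => Or.inl ?_⟩
    · rintro rfl; exact h₂ hy
    · rintro rfl; exact h₄ hx

theorem spaced_map_shift_append_one_cons {u v : List ℕ} :
    Spaced (u.map shift ++ 1 :: v.map shift) ↔ Spaced u ∧ Spaced v := by
  have h : ∀ a, shift a = 0 ↔ a = 0 := by intro a; unfold shift; split_ifs <;> simp_all
  rw [Spaced, List.isChain_append, List.isChain_cons, List.isChain_map, List.isChain_map]
  simp +contextual [Spaced, h]

theorem mem_markedWords {B : List Bool} {i j : ℕ} {p : List ℕ × List ℕ} :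
    p ∈ markedWords B i j ↔
      0 ::ₘ ((p.1 : Multiset ℕ) + (p.2 : Multiset ℕ)) = letters B.length i j ∧
        pinnacles (p.1 ++ [0]) + pinnacles (0 :: p.2) = tops B i ∧
          (Spaced p.1 ∧ Spaced p.2) ∧ p.1.getLast? ≠ some 0 ∧ p.2.head? ≠ some 0 := by
  rw [markedWords, Set.mem_ofPred_eq, mem_blockWords, pinnacles_append_zero_cons,
    spaced_append_zero_cons]
  simp [← Multiset.coe_add, ← Multiset.cons_coe]

/-- The words in `P(eB)^i_j`, cut at their unique letter 1. -/
def cutWords (e : Bool) (B : List Bool) (i j : ℕ) : Set (List ℕ × List ℕ) :=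
  {p | p.1.map shift ++ 1 :: p.2.map shift ∈ blockWords (e :: B) i j}

theorem one_notMem_map_shift (s : Multiset ℕ) : 1 ∉ s.map shift := by
  simp only [Multiset.mem_map, not_exists, not_and]
  exact fun a _ => shift_ne_one a

theorem mem_cutWords {e : Bool} {B : List Bool} {i j : ℕ} {p : List ℕ × List ℕ} :
    p ∈ cutWords e B i j ↔
      (p.1 : Multiset ℕ) + (p.2 : Multiset ℕ) = letters B.length i j ∧
        ((p.1.getLast? = some 0 ∧ p.2.head? = some 0 ↔ e = true) ∧
          pinnacles (p.1 ++ [0]) + pinnacles (0 :: p.2) = tops B i) ∧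
            (Spaced p.1 ∧ Spaced p.2) := by
  have hm := Multiset.map_injective shift_strictMono.injective
  have hc : ∀ s : Multiset ℕ, (s.map shift).count 1 = 0 := fun s =>
    Multiset.count_eq_zero.2 (one_notMem_map_shift s)
  rw [cutWords, Set.mem_ofPred_eq, mem_blockWords, pinnacles_map_shift_append_one_cons,
    spaced_map_shift_append_one_cons, List.length_cons, letters_succ, tops_cons]
  refine and_congr ?_ (and_congr_left fun _ => ?_)
  · rw [← Multiset.coe_add, ← Multiset.cons_coe, Multiset.add_cons, Multiset.cons_inj_right,
      ← Multiset.map_coe, ← Multiset.map_coe, ← Multiset.map_add, hm.eq_iff]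
  -- No shifted letter equals 1, so comparing multiplicities of 1 separates the status of the cut
  -- letter from the remaining pinnacles.
  · constructor
    · intro h
      have h1 := congrArg (Multiset.count 1) h
      rw [Multiset.count_add, Multiset.count_add, hc, hc] at h1
      have he : (p.1.getLast? = some 0 ∧ p.2.head? = some 0 ↔ e = true) := by
        split_ifs at h1 with h2 h3 h3 <;> simp_all
      refine ⟨he, hm ?_⟩
      simpa only [he, add_right_inj] using h
    · rintro ⟨he, h⟩
      simp only [he, h]

theorem cutWords_injective : Function.Injective fun p : List ℕ × List ℕ =>
    p.1.map shift ++ 1 :: p.2.map shift := by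
  have h1 : ∀ u : List ℕ, 1 ∉ u.map shift := fun u => one_notMem_map_shift u
  have hi := List.map_injective_iff.2 shift_strictMono.injective
  rintro ⟨u, v⟩ ⟨u', v'⟩ h
  dsimp only at h
  obtain ⟨h₁, -, h₂⟩ := (List.append_cons_inj_of_notMem (h1 u) (h1 v)).1 h
  exact Prod.ext (hi h₁) (hi h₂)

theorem exists_map_shift_of_one_notMem {s : List ℕ} (h : 1 ∉ s) : ∃ u : List ℕ, s = u.map shift := by
  refine ⟨s.map fun a => a - 1, ?_⟩
  rw [List.map_map]
  conv_lhs => rw [← List.map_id s]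
  refine List.map_congr_left fun a ha => ?_
  have : a ≠ 1 := fun h' => h (h' ▸ ha)
  simp only [id, Function.comp, shift]
  split_ifs <;> omega

theorem ncard_cutWords (e : Bool) (B : List Bool) (i j : ℕ) :
    (cutWords e B i j).ncard = blockCount (e :: B) i j := by
  rw [blockCount, ← Set.ncard_image_of_injective _ cutWords_injective]
  congr 1
  ext w
  refine ⟨?_, fun hw => ?_⟩
  · rintro ⟨p, hp, rfl⟩
    exact hp
  · have hl : (w : Multiset ℕ) = 1 ::ₘ (letters B.length i j).map shift := by
      rw [← letters_succ]; exact (mem_blockWords.1 hw).1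
    have h1 : 1 ∈ w := by
      rw [← Multiset.mem_coe, hl]; exact Multiset.mem_cons_self _ _
    obtain ⟨s, t, rfl⟩ := List.append_of_mem h1
    rw [← Multiset.coe_add, ← Multiset.cons_coe, Multiset.add_cons, Multiset.cons_inj_right] at hl
    have hn : 1 ∉ (s : Multiset ℕ) + t := hl ▸ one_notMem_map_shift _
    simp only [Multiset.mem_add, Multiset.mem_coe, not_or] at hn
    obtain ⟨u, rfl⟩ := exists_map_shift_of_one_notMem hn.1
    obtain ⟨v, rfl⟩ := exists_map_shift_of_one_notMem hn.2
    exact ⟨(u, v), hw, rfl⟩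

theorem getLast?_eq_some_zero_iff {u : List ℕ} (hu : Spaced u) :
    u.getLast? = some 0 ↔ ∃ u' : List ℕ, u = u' ++ [0] ∧ Spaced u' ∧ u'.getLast? ≠ some 0 := by
  constructor
  · intro h
    obtain ⟨u', rfl⟩ := List.getLast?_eq_some_iff.1 h
    have := (spaced_append_zero_cons (v := [])).1 hu
    exact ⟨u', rfl, this.1.1, this.2.1⟩
  · rintro ⟨u', rfl, -⟩
    simp

theorem head?_eq_some_zero_iff {v : List ℕ} (hv : Spaced v) :
    v.head? = some 0 ↔ ∃ v' : List ℕ, v = 0 :: v' ∧ Spaced v' ∧ v'.head? ≠ some 0 := by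
  constructor
  · intro h
    obtain ⟨v', rfl⟩ := List.head?_eq_some_iff.1 h
    have := (spaced_append_zero_cons (u := [])).1 hv
    exact ⟨v', rfl, this.1.2, this.2.2⟩
  · rintro ⟨v', rfl, -⟩
    simp

theorem spaced_append_zero {u : List ℕ} : Spaced (u ++ [0]) ↔ Spaced u ∧ u.getLast? ≠ some 0 := by
  rw [spaced_append_zero_cons (v := [])]
  simp [Spaced]

theorem spaced_zero_cons {v : List ℕ} : Spaced (0 :: v) ↔ Spaced v ∧ v.head? ≠ some 0 := by
  have := spaced_append_zero_cons (u := []) (v := v)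
  simpa [Spaced] using this

theorem pinnacles_append_zero_append_zero (u : List ℕ) :
    pinnacles (u ++ [0] ++ [0]) = pinnacles (u ++ [0]) := by
  rw [List.append_assoc, List.singleton_append, pinnacles_append_zero_cons]
  simp [pinnacles]

theorem pinnacles_zero_cons_zero_cons (v : List ℕ) :
    pinnacles (0 :: 0 :: v) = pinnacles (0 :: v) := by
  have := pinnacles_append_zero_cons [0] v
  simpa [pinnacles] using this

theorem coe_append_singleton (u : List ℕ) (a : ℕ) :
    ((u ++ [a] : List ℕ) : Multiset ℕ) = a ::ₘ (u : Multiset ℕ) := by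
  rw [← Multiset.coe_add, Multiset.coe_singleton, add_comm, Multiset.singleton_add]

theorem append_zero_injective :
    Function.Injective fun p : List ℕ × List ℕ => (p.1 ++ [0], p.2) := by
  rintro ⟨u, v⟩ ⟨u', v'⟩ h
  simpa using h

theorem zero_cons_injective :
    Function.Injective fun p : List ℕ × List ℕ => (p.1, 0 :: p.2) := by
  rintro ⟨u, v⟩ ⟨u', v'⟩ h
  simpa using h

/-- The 1 is not a pinnacle, so at most one of its neighbours is a zero. With no zero beside it,
turning it into a zero creates a new marked zero. Otherwise it merges with the zero on its left or
on its right, and the number of zeros stays the same. -/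
theorem cutWords_false (B : List Bool) (i j : ℕ) :
    cutWords false B i j = markedWords B i (j + 1) ∪
      ((fun p : List ℕ × List ℕ => (p.1 ++ [0], p.2)) '' markedWords B i j ∪
        (fun p : List ℕ × List ℕ => (p.1, 0 :: p.2)) '' markedWords B i j) := by
  ext ⟨u, v⟩
  simp only [Set.mem_union, Set.mem_image, Prod.exists, Prod.mk.injEq]
  constructor
  · intro h
    rw [mem_cutWords] at h
    obtain ⟨h₁, ⟨h₂, h₃⟩, hu, hv⟩ := h
    dsimp only at *
    by_cases h4 : u.getLast? = some 0
    · have h5 : v.head? ≠ some 0 := fun h5 => by simpa using h₂.1 ⟨h4, h5⟩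
      obtain ⟨u', rfl, hu', hu''⟩ := (getLast?_eq_some_zero_iff hu).1 h4
      refine Or.inr (Or.inl ⟨u', v, ?_, rfl, rfl⟩)
      rw [mem_markedWords]
      refine ⟨?_, ?_, ⟨hu', hv⟩, hu'', h5⟩
      · rw [← h₁, coe_append_singleton, Multiset.cons_add]
      · rw [← h₃, pinnacles_append_zero_append_zero]
    · by_cases h5 : v.head? = some 0
      · obtain ⟨v', rfl, hv', hv''⟩ := (head?_eq_some_zero_iff hv).1 h5
        refine Or.inr (Or.inr ⟨u, v', ?_, rfl, rfl⟩)
        rw [mem_markedWords]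
        refine ⟨?_, ?_, ⟨hu, hv'⟩, h4, hv''⟩
        · rw [← h₁, ← Multiset.cons_coe, Multiset.add_cons]
        · rw [← h₃, pinnacles_zero_cons_zero_cons]
      · left
        rw [mem_markedWords]
        exact ⟨by rw [letters_succ_right, h₁], h₃, ⟨hu, hv⟩, h4, h5⟩
  · rintro (h | ⟨u', v', h, rfl, rfl⟩ | ⟨u', v', h, rfl, rfl⟩)
    · rw [mem_markedWords] at h
      obtain ⟨h₁, h₃, h₂, h4, h5⟩ := h
      rw [letters_succ_right, Multiset.cons_inj_right] at h₁
      rw [mem_cutWords]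
      exact ⟨h₁, ⟨by simp [h4], h₃⟩, h₂⟩
    · rw [mem_markedWords] at h
      obtain ⟨h₁, h₃, h₂, h4, h5⟩ := h
      rw [mem_cutWords]
      refine ⟨?_, ⟨by simp [h5], ?_⟩, spaced_append_zero.2 ⟨h₂.1, h4⟩, h₂.2⟩
      · rw [← h₁, coe_append_singleton, Multiset.cons_add]
      · rw [← h₃, pinnacles_append_zero_append_zero]
    · rw [mem_markedWords] at h
      obtain ⟨h₁, h₃, h₂, h4, h5⟩ := h
      rw [mem_cutWords]
      refine ⟨?_, ⟨by simp [h4], ?_⟩, h₂.1, spaced_zero_cons.2 ⟨h₂.2, h5⟩⟩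
      · rw [← h₁, ← Multiset.cons_coe, Multiset.add_cons]
      · rw [← h₃, pinnacles_zero_cons_zero_cons]

theorem cutWords_true_zero (B : List Bool) (i : ℕ) : cutWords true B i 0 = ∅ := by
  refine Set.eq_empty_iff_forall_notMem.2 fun ⟨u, v⟩ h => ?_
  rw [mem_cutWords] at h
  have h0 := congrArg (Multiset.count 0) h.1
  rw [count_zero_letters] at h0
  obtain ⟨v', hv⟩ := List.head?_eq_some_iff.1 (h.2.1.1.2 rfl).2
  simp only at hv
  simp [hv] at h0

/-- Here both neighbours of the 1 are zeros. Merging $0\,1\,0$ into a single marked zero lowers the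
number of zeros by one. -/
theorem cutWords_true_succ (B : List Bool) (i j : ℕ) :
    cutWords true B i (j + 1) =
      (fun p : List ℕ × List ℕ => (p.1 ++ [0], 0 :: p.2)) '' markedWords B i j := by
  ext ⟨u, v⟩
  simp only [Set.mem_image, Prod.exists, Prod.mk.injEq]
  constructor
  · intro h
    rw [mem_cutWords] at h
    obtain ⟨h₁, ⟨h₂, h₃⟩, hu, hv⟩ := h
    dsimp only at *
    obtain ⟨u', rfl, hu', hu''⟩ := (getLast?_eq_some_zero_iff hu).1 (h₂.2 rfl).1
    obtain ⟨v', rfl, hv', hv''⟩ := (head?_eq_some_zero_iff hv).1 (h₂.2 rfl).2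
    refine ⟨u', v', ?_, rfl, rfl⟩
    rw [mem_markedWords]
    refine ⟨?_, ?_, ⟨hu', hv'⟩, hu'', hv''⟩
    · rwa [coe_append_singleton, ← Multiset.cons_coe, Multiset.add_cons, Multiset.cons_add,
        letters_succ_right, Multiset.cons_inj_right] at h₁
    · rw [← h₃, pinnacles_append_zero_append_zero, pinnacles_zero_cons_zero_cons]
  · rintro ⟨u', v', h, rfl, rfl⟩
    rw [mem_markedWords] at h
    obtain ⟨h₁, h₃, h₂, h4, h5⟩ := h
    rw [mem_cutWords]
    refine ⟨?_, ⟨by simp, ?_⟩, spaced_append_zero.2 ⟨h₂.1, h4⟩, spaced_zero_cons.2 ⟨h₂.2, h5⟩⟩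
    · rw [coe_append_singleton, ← Multiset.cons_coe, Multiset.add_cons, Multiset.cons_add,
        letters_succ_right, Multiset.cons_inj_right, h₁]
    · rw [← h₃, pinnacles_append_zero_append_zero, pinnacles_zero_cons_zero_cons]

theorem blockCount_false_cons (B : List Bool) (i j : ℕ) :
    blockCount (false :: B) i j =
      (j + 1) * blockCount B i (j + 1) + 2 * (j * blockCount B i j) := by
  have hf := finite_markedWords B i j
  have hd₁ : Disjoint
      ((fun p : List ℕ × List ℕ => (p.1 ++ [0], p.2)) '' markedWords B i j)
      ((fun p : List ℕ × List ℕ => (p.1, 0 :: p.2)) '' markedWords B i j) := by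
    rw [Set.disjoint_left]
    rintro _ ⟨p, hp, rfl⟩ ⟨q, hq, h⟩
    have h2 : 0 :: q.2 = p.2 := congrArg Prod.snd h
    exact (mem_markedWords.1 hp).2.2.2.2 (by rw [← h2]; rfl)
  have hd₂ : Disjoint (markedWords B i (j + 1))
      ((fun p : List ℕ × List ℕ => (p.1 ++ [0], p.2)) '' markedWords B i j ∪
        (fun p : List ℕ × List ℕ => (p.1, 0 :: p.2)) '' markedWords B i j) := by
    rw [Set.disjoint_left]
    rintro p hp (⟨q, hq, rfl⟩ | ⟨q, hq, rfl⟩)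
    · exact (mem_markedWords.1 hp).2.2.2.1 (by simp)
    · exact (mem_markedWords.1 hp).2.2.2.2 (by simp)
  rw [← ncard_cutWords, cutWords_false, Set.ncard_union_eq hd₂ (finite_markedWords _ _ _)
    ((hf.image _).union (hf.image _)), Set.ncard_union_eq hd₁ (hf.image _) (hf.image _),
    Set.ncard_image_of_injective _ append_zero_injective,
    Set.ncard_image_of_injective _ zero_cons_injective, ncard_markedWords, ncard_markedWords,
    two_mul]

theorem blockCount_true_cons_zero (B : List Bool) (i : ℕ) :
    blockCount (true :: B) i 0 = 0 := by
  rw [← ncard_cutWords, cutWords_true_zero, Set.ncard_empty]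

theorem blockCount_true_cons_succ (B : List Bool) (i j : ℕ) :
    blockCount (true :: B) i (j + 1) = j * blockCount B i j := by
  rw [← ncard_cutWords, cutWords_true_succ, Set.ncard_image_of_injective, ncard_markedWords]
  rintro ⟨u, v⟩ ⟨u', v'⟩ h
  simpa using h

/-! ### The empty block -/

/-- The word `0 1 0 1 ⋯ 1 0` with `i` ones. -/
def alternating : ℕ → List ℕ
  | 0 => [0]
  | i + 1 => 0 :: 1 :: alternating i

theorem card_pinnacles_cons_le (a : ℕ) (w : List ℕ) (hw : ∀ b ∈ w, b ≤ 1) :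
    (pinnacles (a :: w)).card ≤ w.count 1 := by
  induction w generalizing a with
  | nil => simp [pinnacles]
  | cons b w ih =>
    rcases w with _ | ⟨c, w⟩
    · simp [pinnacles]
    · have ih := ih b (fun x hx => hw x (List.mem_cons_of_mem _ hx))
      have hb : b ≤ 1 := hw b (by simp)
      rw [List.count_cons (a := 1) (b := b), pinnacles]
      split_ifs with h h' h'
      · simpa using ih
      · have : b = 1 := by omega
        simp [this] at h'
      · omega
      · exact ih

/-- Only ones can be pinnacles, so equality forces every 1 to be one, that is, to stand between two
zeros. As no two zeros are adjacent, the word is forced two letters at a time. -/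
theorem eq_alternating_of_card_pinnacles (w : List ℕ) (hw : ∀ b ∈ w, b ≤ 1) (hs : Spaced w)
    (h : (pinnacles w).card = w.count 1) (hne : w ≠ []) : w = alternating (w.count 1) := by
  induction hn : w.length using Nat.strong_induction_on generalizing w with | _ n IH =>
  rcases w with _ | ⟨a, w⟩
  · exact absurd rfl hne
  · have h1 := card_pinnacles_cons_le a w fun x hx => hw x (List.mem_cons_of_mem _ hx)
    have ha : a = 0 := by
      by_contra ha
      have : a = 1 := le_antisymm (hw a (by simp)) (Nat.one_le_iff_ne_zero.2 ha)
      subst this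
      rw [List.count_cons_self] at h
      omega
    subst ha
    rcases w with _ | ⟨b, _ | ⟨c, w⟩⟩
    · simp [alternating]
    · have hb : b = 1 := by
        have := hw b (by simp)
        have : b ≠ 0 := by rintro rfl; simp [Spaced] at hs
        omega
      subst hb
      simp [pinnacles] at h
    · have hb : b = 1 := by
        have := hw b (by simp)
        have : b ≠ 0 := by rintro rfl; simp [Spaced] at hs
        omega
      subst hb
      have h2 := card_pinnacles_cons_le 1 (c :: w) fun x hx =>
        hw x (List.mem_cons_of_mem _ (List.mem_cons_of_mem _ hx))
      -- If the word began with 0 1 1, the first of these ones would not be a pinnacle, and the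
      -- bound `h2` would leave too few pinnacles.
      have hc : c = 0 := by
        have := hw c (by simp)
        by_contra hc
        have : c = 1 := by omega
        subst this
        rw [pinnacles, if_neg (by simp)] at h
        simp only [List.count_cons_self, List.count_cons_of_ne zero_ne_one] at h h2
        omega
      subst hc
      have h3 : pinnacles (1 :: 0 :: w) = pinnacles (0 :: w) := by
        rcases w with _ | ⟨d, w⟩ <;> simp [pinnacles]
      have h4 : pinnacles (0 :: 1 :: 0 :: w) = 1 ::ₘ pinnacles (1 :: 0 :: w) := by
        simp [pinnacles]
      rw [h4, h3] at h
      have ih := IH (0 :: w).length (by simp [← hn]) (0 :: w)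
        (fun x hx => hw x (List.mem_cons_of_mem _ (List.mem_cons_of_mem _ hx)))
        (by simp [Spaced] at hs ⊢; exact hs) (by simpa using h) (by simp) rfl
      have h5 : (0 :: 1 :: 0 :: w).count 1 = (0 :: w).count 1 + 1 := by simp
      rw [h5, alternating, ← ih]

theorem alternating_spec (i : ℕ) :
    (∃ w, alternating i = 0 :: w) ∧ pinnacles (alternating i) = Multiset.replicate i 1 ∧
      Spaced (alternating i) ∧
        (alternating i : Multiset ℕ) = Multiset.replicate (i + 1) 0 + Multiset.replicate i 1 := by
  induction i with
  | zero => simp [alternating, pinnacles, Spaced]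
  | succ i ih =>
    obtain ⟨⟨w, hw⟩, h₁, h₂, h₃⟩ := ih
    have h3 : pinnacles (1 :: 0 :: w) = pinnacles (0 :: w) := by
      rcases w with _ | ⟨d, w⟩ <;> simp [pinnacles]
    refine ⟨⟨_, rfl⟩, ?_, ?_, ?_⟩
    · rw [alternating, hw, pinnacles, if_pos (by simp), h3, ← hw, h₁, Multiset.replicate_succ]
    · rw [hw] at h₂
      simp [alternating, hw, Spaced] at h₂ ⊢
      exact h₂
    · rw [alternating, ← Multiset.cons_coe, ← Multiset.cons_coe, h₃,
        Multiset.replicate_succ (n := i + 1), Multiset.replicate_succ (n := i) (a := 1),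
        Multiset.cons_add, Multiset.add_cons, Multiset.cons_swap 0 1]

/-- For the empty block the largest letter `n + 1` is 1, so the words have letters 0 and 1 only. The
empty word is the source of the exceptional constant in `emptyPoly 0`. -/
theorem mem_blockWords_nil {i j : ℕ} {w : List ℕ} :
    w ∈ blockWords [] i j ↔ (w = [] ∧ i = 0 ∧ j = 0) ∨ (w = alternating i ∧ j = i + 1) := by
  have ht : tops [] i = Multiset.replicate i 1 := by simp [tops, ones]
  have hl : letters 0 i j = Multiset.replicate j 0 + Multiset.replicate i 1 := by simp [letters]
  rw [mem_blockWords, ht, List.length_nil, hl]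
  constructor
  · rintro ⟨h₁, h₂, h₃⟩
    by_cases hw : w = []
    · subst hw
      have := congrArg Multiset.card h₁
      simp at this
      left; exact ⟨rfl, by omega, by omega⟩
    · right
      have hc : w.count 1 = i := by
        rw [← Multiset.coe_count, h₁]; simp [Multiset.count_replicate]
      have hc0 : w.count 0 = j := by
        rw [← Multiset.coe_count, h₁]; simp [Multiset.count_replicate]
      have hwa : w = alternating i := by
        have := eq_alternating_of_card_pinnacles w ?_ h₃ (by rw [h₂, hc]; simp) hw
        · rwa [hc] at this
        · intro b hb
          rw [← Multiset.mem_coe, h₁, Multiset.mem_add] at hb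
          rcases hb with hb | hb <;> simp [Multiset.eq_of_mem_replicate hb]
      refine ⟨hwa, ?_⟩
      rw [← hc0, hwa, ← Multiset.coe_count, (alternating_spec i).2.2.2]
      simp [Multiset.count_replicate]
  · rintro (⟨rfl, rfl, rfl⟩ | ⟨rfl, rfl⟩)
    · simp [pinnacles, Spaced]
    · obtain ⟨-, h₁, h₂, h₃⟩ := alternating_spec i
      exact ⟨h₃, h₁, h₂⟩

theorem blockCount_nil (i j : ℕ) :
    blockCount [] i j = (if j = i + 1 then 1 else 0) + if i = 0 ∧ j = 0 then 1 else 0 := by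
  have e : blockWords [] i j =
      {w | (w = [] ∧ i = 0 ∧ j = 0) ∨ (w = alternating i ∧ j = i + 1)} :=
    Set.ext fun _ => mem_blockWords_nil
  rw [blockCount, e]
  by_cases h : j = i + 1
  · subst h; simp
  · by_cases h' : i = 0 ∧ j = 0
    · obtain ⟨rfl, rfl⟩ := h'; simp
    · simp [h, h']

/-! ### Generating polynomials -/

section GeneratingPolynomials

open Polynomial

/-- The action of one letter of a block on the generating polynomials `∑ⱼ p(B)^i_j X^j`. -/
noncomputable def letterOp (e : Bool) : ℚ[X] →ₗ[ℚ] ℚ[X] :=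
  LinearMap.mulLeft ℚ (if e then X ^ 2 else 1 + C 2 * X) ∘ₗ derivative

/-- The action of a block on generating polynomials. -/
noncomputable def blockOp : List Bool → ℚ[X] →ₗ[ℚ] ℚ[X]
  | [] => LinearMap.id
  | e :: B => letterOp e ∘ₗ blockOp B

theorem letterOp_false (p : ℚ[X]) : letterOp false p = (1 + C 2 * X) * derivative p := by
  simp [letterOp]

theorem letterOp_true (p : ℚ[X]) : letterOp true p = X ^ 2 * derivative p := by
  simp [letterOp]

theorem blockOp_append (B₁ B₂ : List Bool) (p : ℚ[X]) :
    blockOp (B₁ ++ B₂) p = blockOp B₁ (blockOp B₂ p) := by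
  induction B₁ with
  | nil => rfl
  | cons e B ih => simp [blockOp, ih]

/-- The letter applied first differentiates the constant away. This makes the constant in
`emptyPoly` irrelevant for non-empty blocks. -/
theorem blockOp_C {B : List Bool} (hB : B ≠ []) (a : ℚ) : blockOp B (C a) = 0 := by
  induction B with
  | nil => exact absurd rfl hB
  | cons e B ih =>
    by_cases h : B = []
    · subst h; simp [blockOp, letterOp]
    · simp [blockOp, ih h]

/-- The generating polynomial of the empty block. -/
noncomputable def emptyPoly (i : ℕ) : ℚ[X] := X ^ (i + 1) + C (if i = 0 then 1 else 0)

theorem coeff_blockOp (B : List Bool) (i j : ℕ) :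
    (blockOp B (emptyPoly i)).coeff j = blockCount B i j := by
  induction B generalizing j with
  | nil =>
    rw [blockCount_nil, blockOp, LinearMap.id_apply, emptyPoly, coeff_add, coeff_X_pow, coeff_C]
    by_cases h : i = 0 <;> simp [h]
  | cons e B ih =>
    rw [blockOp, LinearMap.comp_apply]
    cases e
    · rw [letterOp_false, blockCount_false_cons, add_mul, one_mul, mul_assoc, coeff_add,
        coeff_C_mul, coeff_derivative, ih]
      rcases j with _ | j
      · simp
      · rw [coeff_X_mul, coeff_derivative, ih]
        push_cast; ring
    · rw [letterOp_true]
      rcases j with _ | _ | j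
      · simp [blockCount_true_cons_zero]
      · simp [blockCount_true_cons_succ, coeff_X_pow_mul']
      · rw [coeff_X_pow_mul, coeff_derivative, ih, blockCount_true_cons_succ]
        push_cast; ring

/-- The operator of a zero does not raise the degree, and that of a one raises it by at most one.
This bounds the range of summation in the block recursion and makes it finite. -/
theorem blockCount_eq_zero {B : List Bool} {i j : ℕ} (h : B.count true + i + 1 < j) :
    blockCount B i j = 0 := by
  induction B generalizing j with
  | nil =>
    simp only [List.count_nil] at h
    rw [blockCount_nil, if_neg (by omega), if_neg (by omega)]
  | cons e B ih =>
    cases e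
    · rw [List.count_cons_of_ne (by simp)] at h
      rw [blockCount_false_cons, ih (by omega), ih (by omega)]
      simp
    · rw [List.count_cons_self] at h
      obtain ⟨j, rfl⟩ : ∃ k, j = k + 1 := ⟨j - 1, by omega⟩
      rw [blockCount_true_cons_succ, ih (by omega), mul_zero]

theorem natDegree_blockOp_le (B : List Bool) (i : ℕ) :
    (blockOp B (emptyPoly i)).natDegree ≤ B.count true + i + 1 := by
  rw [natDegree_le_iff_coeff_eq_zero]
  intro j hj
  rw [coeff_blockOp, blockCount_eq_zero hj, Nat.cast_zero]

theorem blockRecursion_blockCount :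
    BlockRecursion fun B i j => (blockCount B i j : ℚ) := by
  intro B₁ B₂ h₁ _ i j
  set N := B₂.count true + i + 1 with hN
  -- A zero of the words for `B₂` plays the part of a top letter for `B₁`: the power $X^{a+1}$ is,
  -- up to a constant, the starting polynomial with upper index $a$. This explains the index `a - 1`
  -- in the recursion.
  have hX : ∀ a, blockOp B₁ (X ^ (a + 1)) = blockOp B₁ (emptyPoly a) := by
    intro a
    rw [emptyPoly, map_add, blockOp_C h₁, add_zero]
  have e := as_sum_range_C_mul_X_pow' (blockOp B₂ (emptyPoly i))
    (Nat.lt_succ_of_le (natDegree_blockOp_le B₂ i))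
  have key : blockOp (B₁ ++ B₂) (emptyPoly i) =
      ∑ a ∈ Finset.range N, C ((blockCount B₂ i (a + 1) : ℕ) : ℚ) * blockOp B₁ (emptyPoly a) := by
    rw [blockOp_append, e, map_sum, Finset.sum_range_succ', pow_zero, mul_one, blockOp_C h₁,
      add_zero]
    refine Finset.sum_congr rfl fun a _ => ?_
    rw [C_mul', map_smul, hX, coeff_blockOp, C_mul']
  have hI : Finset.Icc 1 N = Finset.Ico 1 (N + 1) := by
    ext a; simp
  dsimp only
  rw [← coeff_blockOp, key, finsetSum_coeff, hI, Finset.sum_Ico_eq_sum_range, Nat.add_sub_cancel]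
  refine Finset.sum_congr rfl fun a _ => ?_
  rw [coeff_C_mul, coeff_blockOp, mul_comm, add_comm 1 a, Nat.add_sub_cancel]

/-! ### Segregated blocks and Stirling numbers -/

theorem blockOp_replicate_true (i y : ℕ) :
    blockOp (List.replicate y true) (X ^ (i + 1)) =
      C (((i + y).factorial : ℚ) / i.factorial) * X ^ (i + y + 1) := by
  induction y with
  | zero =>
    simp [blockOp, div_self (Nat.cast_ne_zero.2 i.factorial_ne_zero : (i.factorial : ℚ) ≠ 0)]
  | succ y ih =>
    rw [List.replicate_succ, blockOp, LinearMap.comp_apply, ih, letterOp_true]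
    simp only [derivative_mul, derivative_C, zero_mul, zero_add, derivative_X_pow, ← add_assoc,
      Nat.add_sub_cancel, Nat.factorial_succ]
    have : (((i + y + 1) * (i + y).factorial : ℕ) : ℚ) / i.factorial =
        ((i + y).factorial : ℚ) / i.factorial * ((i + y + 1 : ℕ) : ℚ) := by
      push_cast; ring
    rw [this, C_mul]
    ring

/-- The polynomials `2^{-d} (c)_d (1 + 2X)^d X^{c-d}`. -/
noncomputable def fallingPoly (c d : ℕ) : ℚ[X] :=
  C ((c.descFactorial d : ℚ) / 2 ^ d) * ((1 + C 2 * X) ^ d * X ^ (c - d))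

/-- With $u=1+2X$, `fallingPoly c d` is $u^d(d/du)^dX^c$ and the operator is $2u\,d/du$. The two
summands come from the product rule. -/
theorem letterOp_false_fallingPoly (c d : ℕ) :
    letterOp false (fallingPoly c d) =
      C (2 * d : ℚ) * fallingPoly c d + C 2 * fallingPoly c (d + 1) := by
  have h1 : C 2 * fallingPoly c (d + 1) = C ((c.descFactorial d : ℚ) / 2 ^ d) *
      ((1 + C 2 * X) ^ (d + 1) * (C ((c - d : ℕ) : ℚ) * X ^ (c - d - 1))) := by
    rw [fallingPoly, Nat.descFactorial_succ, ← mul_assoc, ← C_mul, Nat.sub_sub]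
    have : (2 : ℚ) * (((c - d) * c.descFactorial d : ℕ) / 2 ^ (d + 1)) =
        (c.descFactorial d : ℚ) / 2 ^ d * ((c - d : ℕ) : ℚ) := by
      push_cast; field_simp; ring
    rw [this, C_mul]
    ring
  rw [h1, letterOp_false, fallingPoly]
  simp only [derivative_mul, derivative_C, zero_mul, zero_add, derivative_pow, derivative_add, derivative_one, derivative_X, mul_one, C_mul]
  rcases d with _ | d
  · simp
  · simp only [Nat.add_sub_cancel]
    ring

/-- The two terms of `letterOp_false_fallingPoly` reproduce the recursion
$S(x+1,d+1)=(d+1)S(x,d+1)+S(x,d)$. -/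
theorem blockOp_replicate_false (c x : ℕ) :
    blockOp (List.replicate x false) (X ^ c) =
      ∑ d ∈ Finset.range (c + 1),
        C (2 ^ x * (Nat.stirlingSecond x d : ℚ)) * fallingPoly c d := by
  induction x with
  | zero =>
    rw [Finset.sum_range_succ']
    simp [blockOp, fallingPoly]
  | succ x ih =>
    -- The falling factorial of `c` of length `c + 1` vanishes, so no term leaves the range `d ≤ c`.
    have hz : fallingPoly c (c + 1) = 0 := by simp [fallingPoly]
    have h1 : ∑ d ∈ Finset.range (c + 1),
        C (2 ^ x * (Nat.stirlingSecond x d : ℚ)) * (C 2 * fallingPoly c (d + 1)) =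
        ∑ d ∈ Finset.range c,
          C (2 ^ x * (Nat.stirlingSecond x d : ℚ)) * (C 2 * fallingPoly c (d + 1)) := by
      rw [Finset.sum_range_succ, hz, mul_zero, mul_zero, add_zero]
    rw [List.replicate_succ, blockOp, LinearMap.comp_apply, ih, map_sum]
    simp only [C_mul', map_smul, letterOp_false_fallingPoly, smul_add]
    simp only [← C_mul']
    rw [Finset.sum_add_distrib, h1, Finset.sum_range_succ', Finset.sum_range_succ']
    simp only [Nat.stirlingSecond_succ_zero, Nat.cast_zero, mul_zero, map_zero, zero_mul, add_zero]
    rw [← Finset.sum_add_distrib]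
    refine Finset.sum_congr rfl fun d _ => ?_
    rw [Nat.stirlingSecond_succ_succ, ← mul_assoc, ← mul_assoc, ← C_mul, ← C_mul, ← add_mul, ← C_add]
    congr 2
    push_cast; ring

theorem coeff_one_add_two_mul_X_pow (d k : ℕ) :
    ((1 + C 2 * X : ℚ[X]) ^ d).coeff k = d.choose k * 2 ^ k := by
  have : (1 + C 2 * X : ℚ[X]) ^ d = ((1 + X) ^ d).comp (C 2 * X) := by simp
  rw [this, comp_C_mul_X_coeff, coeff_one_add_X_pow]

theorem coeff_fallingPoly {c m j : ℕ} (hm : m ≤ c) (hj : m ≤ j) :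
    (fallingPoly c (c - m)).coeff j =
      (2 : ℚ) ^ ((j : ℤ) - c) * (c.factorial * (1 / (m.factorial : ℚ) *
        ((c - m).choose (j - m) : ℚ))) := by
  have h1 : (m.factorial : ℚ) * (c.descFactorial (c - m) : ℚ) = c.factorial := by
    have := Nat.factorial_mul_descFactorial (Nat.sub_le c m)
    rw [Nat.sub_sub_self hm] at this
    exact_mod_cast this
  have h2 : (m.factorial : ℚ) ≠ 0 := Nat.cast_ne_zero.2 m.factorial_ne_zero
  have h3 : (2 : ℚ) ^ ((j : ℤ) - c) = 2 ^ (j - m) / 2 ^ (c - m) := by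
    rw [← zpow_natCast, ← zpow_natCast, ← zpow_sub₀ two_ne_zero]
    congr 1
    omega
  rw [fallingPoly, Nat.sub_sub_self hm, coeff_C_mul, coeff_mul_X_pow', if_pos hj,
    coeff_one_add_two_mul_X_pow, h3, ← h1]
  field_simp

theorem coeff_fallingPoly_eq_zero {c m j : ℕ} (hm : m ≤ c) (hj : j < m) :
    (fallingPoly c (c - m)).coeff j = 0 := by
  rw [fallingPoly, Nat.sub_sub_self hm, coeff_C_mul, coeff_mul_X_pow', if_neg (by omega), mul_zero]

theorem segregatedFormula_blockCount :
    SegregatedFormula fun B i j => (blockCount B i j : ℚ) := by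
  intro x y i j hxy
  have hne : List.replicate x false ++ List.replicate y true ≠ [] := by
    intro h
    have := congrArg List.length h
    simp at this
    omega
  dsimp only
  rw [← coeff_blockOp, emptyPoly, map_add, blockOp_C hne, add_zero, blockOp_append,
    blockOp_replicate_true, C_mul', map_smul, blockOp_replicate_false, coeff_smul, finsetSum_coeff,
    smul_eq_mul, ← Finset.sum_flip, segregatedValue]
  set c := i + y + 1 with hc
  -- After the substitution $m=c-d$ made by `Finset.sum_flip`, the terms with $m>j$ drop out,
  -- because `fallingPoly c (c - m)` is divisible by $X^m$.
  have hsub : Finset.range (min j c + 1) ⊆ Finset.range (c + 1) := by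
    intro m; simp
  rw [← Finset.sum_subset hsub, Finset.mul_sum, Finset.mul_sum]
  · refine Finset.sum_congr rfl fun m hm => ?_
    have hm' : m ≤ c ∧ m ≤ j := by simp at hm; omega
    rw [coeff_C_mul, coeff_fallingPoly hm'.1 hm'.2]
    have h3 : (2 : ℚ) ^ ((x : ℤ) + j - c) = 2 ^ x * 2 ^ ((j : ℤ) - c) := by
      rw [add_sub_assoc, zpow_add₀ two_ne_zero, zpow_natCast]
    rw [h3, show c - 1 = i + y from by omega]
    ring
  · intro m hm hm'
    simp only [Finset.mem_range] at hm hm'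
    rw [coeff_C_mul, coeff_fallingPoly_eq_zero (by omega) (by omega), mul_zero]

end GeneratingPolynomials

/-! ### Uniqueness of the solution of the two rules -/

theorem eq_blockCount_of_rules {F : List Bool → ℕ → ℕ → ℚ} (hR : BlockRecursion F)
    (hS : SegregatedFormula F) {A : List Bool} (hA : A ≠ []) (i j : ℕ) :
    F A i j = (blockCount A i j : ℚ) := by
  have single : ∀ (e : Bool) (i j : ℕ), F [e] i j = (blockCount [e] i j : ℚ) := by
    intro e i j
    cases e
    · exact (hS 1 0 i j (by omega)).trans (segregatedFormula_blockCount 1 0 i j (by omega)).symm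
    · exact (hS 0 1 i j (by omega)).trans (segregatedFormula_blockCount 0 1 i j (by omega)).symm
  induction A generalizing i j with
  | nil => exact absurd rfl hA
  | cons e B ih =>
    by_cases hB : B = []
    · subst hB; exact single e i j
    · rw [← List.singleton_append, hR [e] B (by simp) hB i j]
      refine Eq.trans ?_ (blockRecursion_blockCount [e] B (by simp) hB i j).symm
      refine Finset.sum_congr rfl fun a _ => ?_
      rw [single, ih hB]

/-! ### Permutations with a given pinnacle set -/

theorem mem_pinnacles {α : Type*} [LinearOrder α] {w : List α} {v : α} :
    v ∈ pinnacles w ↔ ∃ (k : ℕ) (h : k + 2 < w.length),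
      w[k] < w[k + 1] ∧ w[k + 2] < w[k + 1] ∧ v = w[k + 1] := by
  induction w with
  | nil => simp [pinnacles]
  | cons a w ih =>
    rcases w with _ | ⟨b, _ | ⟨c, w⟩⟩
    · simp [pinnacles]
    · simp [pinnacles]
    · have hs : (∃ (k : ℕ) (h : k + 2 < (a :: b :: c :: w).length),
          (a :: b :: c :: w)[k] < (a :: b :: c :: w)[k + 1] ∧
            (a :: b :: c :: w)[k + 2] < (a :: b :: c :: w)[k + 1] ∧
              v = (a :: b :: c :: w)[k + 1]) ↔
          ((a < b ∧ c < b) ∧ v = b) ∨ v ∈ pinnacles (b :: c :: w) := by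
        rw [ih]
        constructor
        · rintro ⟨_ | k, h, h₁, h₂, h₃⟩
          · exact Or.inl ⟨⟨h₁, h₂⟩, h₃⟩
          · exact Or.inr ⟨k, by simpa using h, h₁, h₂, h₃⟩
        · rintro (⟨⟨h₁, h₂⟩, h₃⟩ | ⟨k, h, h₁, h₂, h₃⟩)
          · exact ⟨0, by simp, h₁, h₂, h₃⟩
          · exact ⟨k + 1, by simpa using h, h₁, h₂, h₃⟩
      rw [hs, pinnacles]
      split_ifs with h
      · simp [h]
      · simp [h]

theorem pinnacles_cons_le {α : Type*} [LinearOrder α] (a : α) (w : List α) :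
    pinnacles (a :: w) ≤ (w : Multiset α) := by
  induction w generalizing a with
  | nil => simp [pinnacles]
  | cons b w ih =>
    rcases w with _ | ⟨c, w⟩
    · simp [pinnacles]
    · rw [pinnacles, ← Multiset.cons_coe]
      split_ifs
      · exact Multiset.cons_le_cons b (ih b)
      · exact (ih b).trans (Multiset.le_cons_self _ _)

theorem pinnacles_le {α : Type*} [LinearOrder α] (w : List α) :
    pinnacles w ≤ (w : Multiset α) := by
  rcases w with _ | ⟨a, w⟩
  · simp [pinnacles]
  · rw [← Multiset.cons_coe]
    exact (pinnacles_cons_le a w).trans (Multiset.le_cons_self _ _)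

/-- The word `π_1 ⋯ π_n` of a permutation. -/
def permWord {n : ℕ} (π : Equiv.Perm (Fin n)) : List ℕ :=
  List.ofFn fun t => (π t : ℕ) + 1

theorem permWord_injective (n : ℕ) : Function.Injective (permWord (n := n)) := by
  intro π σ h
  have := List.ofFn_injective h
  ext t
  simpa using congrFun this t

theorem coe_permWord {n : ℕ} (π : Equiv.Perm (Fin n)) :
    (permWord π : Multiset ℕ) = (Finset.Icc 1 n).val := by
  have hn : (permWord π).Nodup := List.nodup_ofFn_ofInjective (by
    intro s t h
    exact π.injective (Fin.ext (by simpa using h)))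
  refine (Multiset.Nodup.ext (Multiset.coe_nodup.2 hn) (Finset.nodup _)).2 fun a => ?_
  simp only [permWord, Multiset.mem_coe, List.mem_ofFn, Finset.mem_val, Finset.mem_Icc]
  constructor
  · rintro ⟨t, rfl⟩
    have := (π t).2
    omega
  · rintro ⟨h, h'⟩
    exact ⟨π.symm ⟨a - 1, by omega⟩, by simp; omega⟩

theorem exists_permWord {n : ℕ} {w : List ℕ} (hw : (w : Multiset ℕ) = (Finset.Icc 1 n).val) :
    ∃ π : Equiv.Perm (Fin n), permWord π = w := by
  have hl : w.length = n := by
    have := congrArg Multiset.card hw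
    simpa using this
  have hn : w.Nodup := by
    rw [← Multiset.coe_nodup, hw]; exact Finset.nodup _
  have hm : ∀ a ∈ w, 1 ≤ a ∧ a ≤ n := fun a ha => by
    rw [← Multiset.mem_coe, hw] at ha
    simpa using ha
  have hb : ∀ t : Fin n, 1 ≤ w[(t : ℕ)]'(hl ▸ t.2) ∧ w[(t : ℕ)]'(hl ▸ t.2) ≤ n := fun t =>
    hm _ (List.getElem_mem _)
  let f : Fin n → Fin n := fun t => ⟨w[(t : ℕ)]'(hl ▸ t.2) - 1, by have := hb t; omega⟩
  have hf : Function.Injective f := by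
    intro s t h
    have h1 : w[(s : ℕ)]'(hl ▸ s.2) - 1 = w[(t : ℕ)]'(hl ▸ t.2) - 1 := congrArg Fin.val h
    have h2 := hb s
    have h3 := hb t
    exact Fin.ext ((hn.getElem_inj_iff).1 (by omega : w[(s : ℕ)]'(hl ▸ s.2) = w[(t : ℕ)]'(hl ▸ t.2)))
  refine ⟨Equiv.ofBijective f (Finite.injective_iff_bijective.1 hf), ?_⟩
  refine List.ext_getElem (by simp [permWord, hl]) fun t h₁ h₂ => ?_
  have := hb ⟨t, hl ▸ h₂⟩
  simp only [permWord, List.getElem_ofFn, Equiv.ofBijective_apply, f]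
  simp only at this
  omega

/-- The letters of a permutation are distinct, so its multiset of pinnacles has no repetitions and
carries no more information than the set. -/
theorem pinnacles_permWord_eq_iff {n : ℕ} (π : Equiv.Perm (Fin n)) (P : Finset ℕ) :
    pinnacles (permWord π) = P.val ↔ pinSet π = (P : Set ℕ) := by
  have hn : (pinnacles (permWord π)).Nodup :=
    Multiset.nodup_of_le (pinnacles_le _) (by rw [coe_permWord]; exact Finset.nodup _)
  rw [Multiset.Nodup.ext hn P.nodup, Set.ext_iff]
  refine forall_congr' fun v => ?_
  have : v ∈ pinnacles (permWord π) ↔ v ∈ pinSet π := by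
    rw [mem_pinnacles]
    simp only [permWord, List.getElem_ofFn, List.length_ofFn, pinSet, Set.mem_ofPred_eq]
    constructor
    · rintro ⟨k, h, h₁, h₂, h₃⟩
      exact ⟨⟨k, by omega⟩, ⟨k + 1, by omega⟩, ⟨k + 2, h⟩, rfl, rfl,
        by simpa using h₁, by simpa using h₂, h₃⟩
    · rintro ⟨⟨a, ha⟩, ⟨b, hb⟩, ⟨c, hc⟩, h, h', h₁, h₂, h₃⟩
      simp only at h h'
      subst h h'
      exact ⟨a, hc, by simpa using h₁, by simpa using h₂, h₃⟩
  rw [this]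
  rfl

theorem length_block (n : ℕ) (P : Finset ℕ) : (block n P).length = n := by
  simp [block]

theorem ones_block {n : ℕ} {P : Finset ℕ} (hP : P ⊆ Finset.Icc 1 n) : ones (block n P) = P := by
  ext t
  rw [mem_ones, length_block]
  constructor
  · rintro ⟨h₁, h₂, h₃⟩
    obtain ⟨t, rfl⟩ : ∃ s, t = s + 1 := ⟨t - 1, by omega⟩
    simpa [block, List.getElem?_range (show t < n by omega)] using h₃
  · intro h
    have h' := Finset.mem_Icc.1 (hP h)
    obtain ⟨t, rfl⟩ : ∃ s, t = s + 1 := ⟨t - 1, by omega⟩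
    refine ⟨h'.1, h'.2, ?_⟩
    simpa [block, List.getElem?_range (show t < n by omega)] using h

theorem blockCount_block {n : ℕ} {P : Finset ℕ} (hP : P ⊆ Finset.Icc 1 n) :
    blockCount (block n P) 0 0 = pinnacleCount n P := by
  have e : blockWords (block n P) 0 0 = permWord '' {π : Equiv.Perm (Fin n) | pinSet π = P} := by
    ext w
    simp only [blockWords, length_block, ones_block hP, Multiset.replicate_zero, add_zero,
      Multiset.zero_le, and_true, Set.mem_ofPred_eq, Set.mem_image]
    constructor
    · rintro ⟨h₁, h₂⟩
      obtain ⟨π, rfl⟩ := exists_permWord h₁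
      exact ⟨π, (pinnacles_permWord_eq_iff π P).1 h₂, rfl⟩
    · rintro ⟨π, h, rfl⟩
      exact ⟨coe_permWord π, (pinnacles_permWord_eq_iff π P).2 h⟩
  rw [blockCount, e, Set.ncard_image_of_injective _ (permWord_injective n)]
  rfl

/-! ### Correctness and running time of programs -/

/-- Started in `s`, the program `p` halts after at most `T` steps in a memory that satisfies
`Q`. -/
def HasRun (p : Program) (s : Memory) (T : ℕ) (Q : Memory → Prop) : Prop :=
  ∃ s' t, Runs p s s' t ∧ t ≤ T ∧ Q s'

theorem HasRun.mono {p : Program} {s : Memory} {T T' : ℕ} {Q Q' : Memory → Prop}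
    (h : HasRun p s T Q) (hT : T ≤ T') (hQ : ∀ s', Q s' → Q' s') : HasRun p s T' Q' := by
  obtain ⟨s', t, hr, ht, hq⟩ := h
  exact ⟨s', t, hr, ht.trans hT, hQ s' hq⟩

theorem hasRun_skip {s : Memory} {Q : Memory → Prop} (h : Q s) : HasRun .skip s 1 Q :=
  ⟨s, 1, .skip s, le_rfl, h⟩

theorem hasRun_setNat {a : ℕ} {e v : NatExpr} {s : Memory} {Q : Memory → Prop}
    (h : Q (s.setNat a (e.eval s) (v.eval s))) :
    HasRun (.setNat a e v) s (e.cost + v.cost + 1) Q :=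
  ⟨_, _, .setNat a e v s, le_rfl, h⟩

theorem hasRun_setRat {a : ℕ} {e : NatExpr} {v : RatExpr} {s : Memory} {Q : Memory → Prop}
    (hd : v.Defined s) (h : Q (s.setRat a (e.eval s) (v.eval s))) :
    HasRun (.setRat a e v) s (e.cost + v.cost + 1) Q :=
  ⟨_, _, .setRat a e v s hd, le_rfl, h⟩

theorem hasRun_seq {p q : Program} {s : Memory} {T₁ T₂ : ℕ} {Q : Memory → Prop}
    (h : HasRun p s T₁ fun s' => HasRun q s' T₂ Q) : HasRun (.seq p q) s (T₁ + T₂) Q := by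
  obtain ⟨s', t, hr, ht, s'', t', hr', ht', hq⟩ := h
  exact ⟨s'', t + t', .seq hr hr', add_le_add ht ht', hq⟩

theorem hasRun_ifLt {e₁ e₂ : NatExpr} {p q : Program} {s : Memory} {T : ℕ} {Q : Memory → Prop}
    (hp : e₁.eval s < e₂.eval s → HasRun p s T Q) (hq : ¬ e₁.eval s < e₂.eval s → HasRun q s T Q) :
    HasRun (.ifLt e₁ e₂ p q) s (e₁.cost + e₂.cost + 1 + T) Q := by
  by_cases h : e₁.eval s < e₂.eval s
  · obtain ⟨s', t, hr, ht, hs⟩ := hp h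
    exact ⟨s', _, .ifTrue h hr, by omega, hs⟩
  · obtain ⟨s', t, hr, ht, hs⟩ := hq h
    exact ⟨s', _, .ifFalse h hr, by omega, hs⟩

/-- The rule for while loops: in `I m s` the number `m` counts the remaining rounds. -/
theorem hasRun_whileLt {e₁ e₂ : NatExpr} {p : Program} {T : ℕ} (I : ℕ → Memory → Prop)
    (hstep : ∀ m s, I (m + 1) s → e₁.eval s < e₂.eval s ∧ HasRun p s T (I m))
    (hend : ∀ s, I 0 s → ¬ e₁.eval s < e₂.eval s) (m : ℕ) (s : Memory) (h : I m s) :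
    HasRun (.whileLt e₁ e₂ p) s (m * (T + (e₁.cost + e₂.cost + 1)) + (e₁.cost + e₂.cost + 1))
      (I 0) := by
  induction m generalizing s with
  | zero => exact ⟨s, _, .whileFalse (hend s h), by omega, h⟩
  | succ m ih =>
    obtain ⟨hg, s₁, t₁, hr₁, ht₁, h₁⟩ := hstep m s h
    obtain ⟨s₂, t₂, hr₂, ht₂, h₂⟩ := ih s₁ h₁
    refine ⟨s₂, _, .whileTrue hg hr₁ hr₂, ?_, h₂⟩
    rw [Nat.succ_mul]
    omega

@[simp] theorem setNat_nat (s : Memory) (a t v : ℕ) :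
    (s.setNat a t v).nat = Function.update s.nat a (Function.update (s.nat a) t v) := rfl

@[simp] theorem setNat_rat (s : Memory) (a t v : ℕ) : (s.setNat a t v).rat = s.rat := rfl

@[simp] theorem setRat_nat (s : Memory) (a t : ℕ) (v : ℚ) : (s.setRat a t v).nat = s.nat := rfl

@[simp] theorem setRat_rat (s : Memory) (a t : ℕ) (v : ℚ) :
    (s.setRat a t v).rat = Function.update s.rat a (Function.update (s.rat a) t v) := rfl

/-- The cell number 0 of a natural array, used as a variable. -/
def natVar (a : ℕ) : NatExpr := .cell a (.const 0)

/-- The cell number 0 of a rational array, used as a variable. -/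
def ratVar (a : ℕ) : RatExpr := .cell a (.const 0)

@[simp] theorem const_eval (s : Memory) (c : ℕ) : (NatExpr.const c).eval s = c := rfl

@[simp] theorem const_cost (c : ℕ) : (NatExpr.const c).cost = 1 := rfl

@[simp] theorem natVar_eval (s : Memory) (a : ℕ) : (natVar a).eval s = s.nat a 0 := rfl

@[simp] theorem natVar_cost (a : ℕ) : (natVar a).cost = 2 := rfl

@[simp] theorem ratVar_eval (s : Memory) (a : ℕ) : (ratVar a).eval s = s.rat a 0 := rfl

@[simp] theorem ratVar_cost (a : ℕ) : (ratVar a).cost = 2 := rfl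

@[simp] theorem ratVar_defined (s : Memory) (a : ℕ) : (ratVar a).Defined s := trivial

/-! ### Fast exponentiation

Natural variables: 3 is the current position, 4 the number of remaining ones, 5 an exponent `x`,
6 a degree `d`, 7 the remaining exponent. Rational variables: 3 is the current square, 4 the
current power. The rational arrays 1 and 2 hold coefficient vectors. -/

/-- One round of the fast exponentiation. -/
def powRound : Program :=
  .seq (.ifLt (.mul (.const 2) (.half (natVar 7))) (natVar 7)
      (.setRat 4 (.const 0) (.mul (ratVar 4) (ratVar 3))) .skip)
    (.seq (.setRat 3 (.const 0) (.mul (ratVar 3) (ratVar 3)))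
      (.setNat 7 (.const 0) (.half (natVar 7))))

/-- The computation of `(2d)^x`. -/
def powProgram : Program :=
  .seq (.setNat 7 (.const 0) (natVar 5))
    (.seq (.setRat 3 (.const 0) (.ofNat (.mul (.const 2) (natVar 6))))
      (.seq (.setRat 4 (.const 0) (.ofNat (.const 1)))
        (.whileLt (.const 0) (natVar 7) powRound)))

/-- The memory cells outside the working space of `powProgram` agree. -/
def PowFrame (s s' : Memory) : Prop :=
  (∀ a, a ≠ 7 → s'.nat a = s.nat a) ∧ ∀ a, a ≠ 3 → a ≠ 4 → s'.rat a = s.rat a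

/-- The invariant of binary exponentiation: power times square to the remaining exponent is
constant, while halving removes one binary digit of the exponent. The number of rounds is thus
`Nat.size` of the exponent. -/
theorem hasRun_powRound (s₀ : Memory) (v : ℚ) (m : ℕ) (s : Memory)
    (h : PowFrame s₀ s ∧ Nat.size (s.nat 7 0) = m + 1 ∧
      s.rat 4 0 * s.rat 3 0 ^ s.nat 7 0 = v) :
    HasRun powRound s 40 fun s' => PowFrame s₀ s' ∧ Nat.size (s'.nat 7 0) = m ∧
      s'.rat 4 0 * s'.rat 3 0 ^ s'.nat 7 0 = v := by
  obtain ⟨⟨hf₁, hf₂⟩, hm, hv⟩ := h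
  have hsize : Nat.size (s.nat 7 0 / 2) = m := by
    have h0 : s.nat 7 0 ≠ 0 := by rintro h0; simp [h0] at hm
    have := Nat.size_bit (b := (s.nat 7 0).bodd) (n := (s.nat 7 0).div2)
      (by rw [Nat.bit_bodd_div2]; exact h0)
    rw [Nat.bit_bodd_div2, hm, Nat.div2_val] at this
    omega
  refine HasRun.mono (hasRun_seq (T₁ := 20) (T₂ := 13) (Q := _) ?_) (by omega) fun _ h => h
  -- Squaring and halving are common to both parities; the preceding test changes at most the
  -- accumulated power, in rational array 4.
  have tail : ∀ s₁ : Memory, s₁.nat = s.nat → (∀ a, a ≠ 4 → s₁.rat a = s.rat a) →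
      s₁.rat 4 0 * (s.rat 3 0 * s.rat 3 0) ^ (s.nat 7 0 / 2) = v →
      HasRun (.seq (.setRat 3 (.const 0) (.mul (ratVar 3) (ratVar 3)))
        (.setNat 7 (.const 0) (.half (natVar 7)))) s₁ 13 fun s' =>
          PowFrame s₀ s' ∧ Nat.size (s'.nat 7 0) = m ∧
            s'.rat 4 0 * s'.rat 3 0 ^ s'.nat 7 0 = v := by
    intro s₁ h₁ h₂ h₃
    refine HasRun.mono (hasRun_seq (hasRun_setRat (by simp [RatExpr.Defined])
      (hasRun_setNat (Q := fun s' => PowFrame s₀ s' ∧ Nat.size (s'.nat 7 0) = m ∧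
            s'.rat 4 0 * s'.rat 3 0 ^ s'.nat 7 0 = v) ?_)))
      (by simp [NatExpr.cost, RatExpr.cost]) fun _ h => h
    refine ⟨⟨fun a ha => ?_, fun a ha ha' => ?_⟩, ?_, ?_⟩
    · simp [h₁, ha, hf₁]
    · simp [h₂, ha, ha', hf₂]
    · simp [h₁, NatExpr.eval, hsize]
    · simpa [h₁, NatExpr.eval, RatExpr.eval, h₂] using h₃
  have hhalf := Nat.div_add_mod (s.nat 7 0) 2
  refine HasRun.mono (hasRun_ifLt (T := 9) (fun hlt => ?_) (fun hlt => ?_))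
    (by simp [NatExpr.cost]) fun _ h => h
  · refine HasRun.mono (hasRun_setRat (by simp [RatExpr.Defined])
      (tail (s.setRat 4 0 (s.rat 4 0 * s.rat 3 0)) rfl ?_ ?_))
      (by simp [NatExpr.cost, RatExpr.cost]) fun _ h => h
    · intro a ha
      simp [ha]
    · simp only [NatExpr.eval, natVar_eval] at hlt
      have h1 : s.nat 7 0 = 2 * (s.nat 7 0 / 2) + 1 := by omega
      rw [← hv]
      conv_rhs => rw [h1]
      simp [pow_succ, pow_mul]
      ring
  · refine HasRun.mono (hasRun_skip (tail _ rfl (fun _ _ => rfl) ?_)) (by omega) fun _ h => h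
    simp only [NatExpr.eval, natVar_eval] at hlt
    have h1 : s.nat 7 0 = 2 * (s.nat 7 0 / 2) := by omega
    rw [← hv]
    conv_rhs => rw [h1]
    rw [pow_mul, sq]

theorem hasRun_powProgram (s : Memory) :
    HasRun powProgram s (50 * Nat.size (s.nat 5 0) + 50) fun s' =>
      PowFrame s s' ∧ s'.rat 4 0 = (2 * (s.nat 6 0 : ℚ)) ^ s.nat 5 0 := by
  set v := (2 * (s.nat 6 0 : ℚ)) ^ s.nat 5 0 with hv
  have loop := hasRun_whileLt (e₁ := .const 0) (e₂ := natVar 7) (p := powRound) (T := 40)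
    (fun m s' => PowFrame s s' ∧ Nat.size (s'.nat 7 0) = m ∧
      s'.rat 4 0 * s'.rat 3 0 ^ s'.nat 7 0 = v)
    (fun m s' h => ⟨by
      simp only [NatExpr.eval, natVar_eval]
      rw [← Nat.size_pos, h.2.1]
      omega, hasRun_powRound s v m s' h⟩)
    (fun s' h => by
      simp only [NatExpr.eval, natVar_eval]
      rw [Nat.size_eq_zero.1 h.2.1]
      omega)
  refine HasRun.mono (hasRun_seq (hasRun_setNat (hasRun_seq (hasRun_setRat trivial
    (hasRun_seq (hasRun_setRat trivial (HasRun.mono (loop (Nat.size (s.nat 5 0)) _ ?_) le_rfl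
      fun s' h => ?_))))))) ?_ fun _ h => h
  · refine ⟨⟨fun a ha => ?_, fun a ha ha' => ?_⟩, ?_, ?_⟩
    · simp [ha]
    · simp [ha, ha']
    · simp
    · simp [RatExpr.eval, NatExpr.eval, hv]
  · obtain ⟨h₁, h₂, h₃⟩ := h
    rw [Nat.size_eq_zero.1 h₂, pow_zero, mul_one] at h₃
    exact ⟨h₁, h₃⟩
  · simp [NatExpr.cost, RatExpr.cost]
    omega

/-! ### Loops over coefficient vectors -/

/-- The natural cells outside the working space of the loops over coefficients agree. -/
def NatFrame (s s' : Memory) : Prop :=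
  ∀ a, a ≠ 6 → a ≠ 7 → s'.nat a = s.nat a

/-- The increment of the degree `d`. -/
def nextDegree : Program := .setNat 6 (.const 0) (.add (natVar 6) (.const 1))

/-- The loop over all degrees `d < k + 2`. -/
def degreeLoop (p : Program) : Program :=
  .seq (.setNat 6 (.const 0) (.const 0))
    (.whileLt (natVar 6) (.add (natVar 1) (.const 2)) (.seq p nextDegree))

/-- The invariant `J d` describes the memory when the counter shows `d`, so the body has to
establish `J (d + 1)` for the memory with the counter already advanced. -/
theorem hasRun_degreeLoop {p : Program} {T : ℕ} (J : ℕ → Memory → Prop) (s : Memory)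
    (h0 : J 0 (s.setNat 6 0 0))
    (hJ : ∀ d s', J d s' → NatFrame s s' → s'.nat 6 0 = d → d < s.nat 1 0 + 2 →
      HasRun p s' T fun s'' => NatFrame s s'' ∧ s''.nat 6 0 = d ∧ J (d + 1) (s''.setNat 6 0 (d + 1))) :
    HasRun (degreeLoop p) s ((s.nat 1 0 + 2) * (T + 20) + 20)
      fun s' => NatFrame s s' ∧ J (s.nat 1 0 + 2) s' := by
  have loop := hasRun_whileLt (e₁ := natVar 6) (e₂ := .add (natVar 1) (.const 2))
    (p := .seq p nextDegree) (T := T + 6)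
    (fun m s' => NatFrame s s' ∧ s'.nat 6 0 + m = s.nat 1 0 + 2 ∧ J (s'.nat 6 0) s')
    (fun m s' h => by
      obtain ⟨h₁, h₂, h₃⟩ := h
      refine ⟨by
        simp only [natVar_eval, NatExpr.eval, h₁ 1 (by decide) (by decide)]
        omega, ?_⟩
      refine HasRun.mono (hasRun_seq (T₂ := 6) (HasRun.mono (hJ _ s' h₃ h₁ rfl (by omega)) le_rfl
        fun s'' h => HasRun.mono (hasRun_setNat (Q := _) ?_) (by simp [NatExpr.cost])
          fun _ h => h)) le_rfl fun _ h => h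
      obtain ⟨h₄, h₅, h₆⟩ := h
      refine ⟨fun a ha ha' => ?_, ?_, ?_⟩
      · simp [ha, h₄ a ha ha']
      · simp [NatExpr.eval, h₅]
        omega
      · simpa [NatExpr.eval, h₅] using h₆)
    (fun s' h => by
      obtain ⟨h₁, h₂, -⟩ := h
      simp only [natVar_eval, NatExpr.eval, h₁ 1 (by decide) (by decide)]
      omega)
  refine HasRun.mono (hasRun_seq (hasRun_setNat (HasRun.mono (loop (s.nat 1 0 + 2) _ ?_) le_rfl
    fun s' h => ?_))) ?_ fun _ h => h
  · refine ⟨fun a ha _ => ?_, ?_, ?_⟩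
    · simp [ha]
    · simp
    · simpa using h0
  · obtain ⟨h₁, h₂, h₃⟩ := h
    rw [add_zero] at h₂
    rw [h₂] at h₃
    exact ⟨h₁, h₃⟩
  · have : T + 6 + ((natVar 6).cost + ((natVar 1).add (.const 2)).cost + 1) ≤ T + 20 := by
      simp [NatExpr.cost]
    have := Nat.mul_le_mul_left (s.nat 1 0 + 2) this
    simp only [NatExpr.cost, natVar_cost] at this ⊢
    omega

/-- The effect of `x` zeros of the block on a coefficient vector. -/
def scaleProgram : Program :=
  degreeLoop (.seq powProgram
    (.setRat 2 (natVar 6) (.mul (.cell 1 (natVar 6)) (ratVar 4))))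

theorem hasRun_scaleProgram (s : Memory) (h2 : ∀ d, s.nat 1 0 + 2 ≤ d → s.rat 2 d = 0) :
    HasRun scaleProgram s
      ((s.nat 1 0 + 2) * (50 * Nat.size (s.nat 5 0) + 80) + 20) fun s' =>
        NatFrame s s' ∧ s'.rat 1 = s.rat 1 ∧
          ∀ d, s'.rat 2 d =
            if d < s.nat 1 0 + 2 then s.rat 1 d * (2 * (d : ℚ)) ^ s.nat 5 0 else 0 := by
  refine HasRun.mono (hasRun_degreeLoop (T := 50 * Nat.size (s.nat 5 0) + 60)
    (fun e s' => s'.rat 1 = s.rat 1 ∧ ∀ d, s'.rat 2 d =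
      if d < e then s.rat 1 d * (2 * (d : ℚ)) ^ s.nat 5 0 else s.rat 2 d) s ⟨rfl, by simp⟩ ?_)
    (by ring_nf; omega) ?_
  · rintro e s' ⟨h₁, h₃⟩ hf he hlt
    have h5 : s'.nat 5 = s.nat 5 := hf 5 (by decide) (by decide)
    refine HasRun.mono (hasRun_seq (T₂ := 10) (HasRun.mono (hasRun_powProgram s') le_rfl
      fun s'' h => HasRun.mono (hasRun_setRat (Q := fun s'' => NatFrame s s'' ∧ s''.nat 6 0 = e ∧
        (s''.setNat 6 0 (e + 1)).rat 1 = s.rat 1 ∧ ∀ d, (s''.setNat 6 0 (e + 1)).rat 2 d =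
        if d < e + 1 then s.rat 1 d * (2 * (d : ℚ)) ^ s.nat 5 0 else s.rat 2 d) ?_ ?_)
        (by simp [RatExpr.cost])
          fun _ h => h)) (by rw [h5]) fun _ h => h
    · simp [RatExpr.Defined]
    · obtain ⟨⟨h4, h6⟩, h7⟩ := h
      have h66 : s''.nat 6 0 = e := by rw [h4 6 (by decide), he]
      refine ⟨fun a ha ha' => ?_, ?_, ?_, fun d => ?_⟩
      · simp [h4 a ha', hf a ha ha']
      · simpa using h66
      · simp [h6, h₁]
      · by_cases hd : d = e
        · subst hd
          simp [RatExpr.eval, h66, h7, h6, h₁, h5, he]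
        · have : d < e + 1 ↔ d < e := by omega
          simp [h66, hd, h6, h₃, this]
  · rintro s' ⟨hf, h₁, h₃⟩
    refine ⟨hf, h₁, fun d => ?_⟩
    rw [h₃]
    split_ifs with h
    · rfl
    -- The loop does not reach these cells; they have to be zero beforehand, because `peakProgram`
    -- reads cell `k + 2` when it computes the coefficient of degree `k + 1`.
    · exact h2 d (by omega)

/-- The effect of a one of the block on a coefficient vector. -/
def peakVec (c : ℕ → ℚ) (d : ℕ) : ℚ :=
  (((d - 1 : ℕ) : ℚ) * c (d - 1) - 2 * (d : ℚ) * c d + ((d : ℚ) + 1) * c (d + 1)) / 2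

/-- The effect of a one of the block on a coefficient vector. -/
def peakProgram : Program :=
  degreeLoop (.setRat 1 (natVar 6) (.div
    (.add (.sub (.mul (.ofNat (.sub (natVar 6) (.const 1))) (.cell 2 (.sub (natVar 6) (.const 1))))
        (.mul (.ofNat (.mul (.const 2) (natVar 6))) (.cell 2 (natVar 6))))
      (.mul (.ofNat (.add (natVar 6) (.const 1))) (.cell 2 (.add (natVar 6) (.const 1)))))
    (.ofNat (.const 2))))

/-- The new coefficient of degree `d` needs the old ones of degrees `d - 1`, `d` and `d + 1`.
Reading from array 2 and writing to array 1 keeps the old values intact. -/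
theorem hasRun_peakProgram (s : Memory) :
    HasRun peakProgram s ((s.nat 1 0 + 2) * 80 + 20) fun s' =>
        NatFrame s s' ∧ s'.rat 2 = s.rat 2 ∧
          ∀ d, s'.rat 1 d = if d < s.nat 1 0 + 2 then peakVec (s.rat 2) d else s.rat 1 d := by
  refine HasRun.mono (hasRun_degreeLoop (T := 60)
    (fun e s' => s'.rat 2 = s.rat 2 ∧ ∀ d, s'.rat 1 d =
      if d < e then peakVec (s.rat 2) d else s.rat 1 d) s ⟨rfl, by simp⟩ ?_)
    (by omega) fun _ h => h
  rintro e s' ⟨h₁, h₃⟩ hf he hlt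
  refine HasRun.mono (hasRun_setRat (Q := fun s'' => NatFrame s s'' ∧ s''.nat 6 0 = e ∧
      (s''.setNat 6 0 (e + 1)).rat 2 = s.rat 2 ∧ ∀ d, (s''.setNat 6 0 (e + 1)).rat 1 d =
      if d < e + 1 then peakVec (s.rat 2) d else s.rat 1 d) ?_ ?_)
      (by simp [NatExpr.cost, RatExpr.cost]) fun _ h => h
  · simp [RatExpr.Defined, RatExpr.eval]
  · refine ⟨fun a ha ha' => ?_, ?_, ?_, fun d => ?_⟩
    · simp [hf a ha ha']
    · simpa using he
    · simp [h₁]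
    · by_cases hd : d = e
      · subst hd
        simp [RatExpr.eval, NatExpr.eval, he, h₁, peakVec]
      · have : d < e + 1 ↔ d < e := by omega
        simp [he, hd, h₃, this]

/-- The sum of the coefficients, after the effect of `x` zeros of the block. -/
def sumProgram : Program :=
  .seq (.setRat 0 (.const 0) (.ofNat (.const 0)))
    (degreeLoop (.seq powProgram (.setRat 0 (.const 0)
      (.add (ratVar 0) (.mul (.cell 1 (natVar 6)) (ratVar 4))))))

theorem hasRun_sumProgram (s : Memory) :
    HasRun sumProgram s
      ((s.nat 1 0 + 2) * (50 * Nat.size (s.nat 5 0) + 81) + 24) fun s' =>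
        s'.output =
          ∑ d ∈ Finset.range (s.nat 1 0 + 2), s.rat 1 d * (2 * (d : ℚ)) ^ s.nat 5 0 := by
  set s₀ := s.setRat 0 0 0 with hs₀
  have loop := hasRun_degreeLoop (p := .seq powProgram (.setRat 0 (.const 0)
      (.add (ratVar 0) (.mul (.cell 1 (natVar 6)) (ratVar 4)))))
    (T := 50 * Nat.size (s.nat 5 0) + 61)
    (fun e s' => s'.rat 1 = s.rat 1 ∧
      s'.rat 0 0 = ∑ d ∈ Finset.range e, s.rat 1 d * (2 * (d : ℚ)) ^ s.nat 5 0) s₀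
    (by simp [hs₀]) (by
    rintro e s' ⟨h₁, h₃⟩ hf he hlt
    have h5 : s'.nat 5 = s.nat 5 := hf 5 (by decide) (by decide)
    refine HasRun.mono (hasRun_seq (T₂ := 11) (HasRun.mono (hasRun_powProgram s') le_rfl
      fun s'' h => HasRun.mono (hasRun_setRat (Q := fun s'' => NatFrame s₀ s'' ∧ s''.nat 6 0 = e ∧
        (s''.setNat 6 0 (e + 1)).rat 1 = s.rat 1 ∧ (s''.setNat 6 0 (e + 1)).rat 0 0 =
        ∑ d ∈ Finset.range (e + 1), s.rat 1 d * (2 * (d : ℚ)) ^ s.nat 5 0) ?_ ?_)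
        (by simp [RatExpr.cost])
          fun _ h => h)) (by rw [h5]) fun _ h => h
    · simp [RatExpr.Defined]
    · obtain ⟨⟨h4, h6⟩, h7⟩ := h
      have h66 : s''.nat 6 0 = e := by rw [h4 6 (by decide), he]
      refine ⟨fun a ha ha' => ?_, ?_, ?_, ?_⟩
      · simp [h4 a ha', hf a ha ha']
      · simpa using h66
      · simp [h6, h₁]
      · rw [Finset.sum_range_succ, ← h₃]
        simp [RatExpr.eval, h66, h7, h6, h₁, h5, he])
  have init : HasRun (.setRat 0 (.const 0) (.ofNat (.const 0))) s 4 fun s' => s' = s₀ :=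
    HasRun.mono (hasRun_setRat (Q := fun s' => s' = s₀) trivial (by simp [hs₀, RatExpr.eval]))
      (by simp [RatExpr.cost]) fun _ h => h
  refine HasRun.mono (hasRun_seq (HasRun.mono init le_rfl fun s' h => ?_))
    (?_ : 4 + ((s.nat 1 0 + 2) * (50 * Nat.size (s.nat 5 0) + 61 + 20) + 20) ≤ _) fun _ h => h
  · rw [h]
    exact HasRun.mono loop le_rfl fun s' h => h.2.2
  · rw [add_assoc (50 * _) 61 20]
    omega

/-! ### The main loop -/

/-- The treatment of the last remaining one of the block and of the zeros behind it. -/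
def oneRound : Program :=
  .seq (.setNat 4 (.const 0) (.sub (natVar 4) (.const 1)))
    (.seq (.setNat 5 (.const 0) (.sub (.sub (natVar 3) (.cell 2 (natVar 4))) (.const 1)))
      (.seq (.setNat 3 (.const 0) (.cell 2 (natVar 4)))
        (.seq scaleProgram peakProgram)))

/-- The program that computes `|p_n(P)|`. -/
def mainProgram : Program :=
  .seq (.setNat 3 (.const 0) (.add (natVar 0) (.const 1)))
    (.seq (.setNat 4 (.const 0) (natVar 1))
      (.seq (.setRat 1 (.const 0) (.div (.ofNat (.const 1)) (.ofNat (.const 2))))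
        (.seq (.setRat 1 (.const 1) (.div (.ofNat (.const 1)) (.ofNat (.const 2))))
          (.seq (.whileLt (.const 0) (natVar 4) oneRound)
            (.seq (.setNat 5 (.const 0) (.sub (natVar 3) (.const 1))) sumProgram)))))

/-- The coefficient vector after the effect of a one and of the `x` zeros behind it. -/
def roundVec (c : ℕ → ℚ) (x : ℕ) : ℕ → ℚ :=
  peakVec fun d => c d * (2 * (d : ℚ)) ^ x

/-- Scaling keeps the degree and $\frac12(u-1)^2\,d/du$ raises it by at most one, so `k` rounds that
start from degree 1 fit into `k + 2` cells. -/
theorem roundVec_eq_zero {c : ℕ → ℚ} {N : ℕ} (hc : ∀ d, N ≤ d → c d = 0) (x d : ℕ)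
    (hd : N + 1 ≤ d) : roundVec c x d = 0 := by
  simp [roundVec, peakVec, hc d (by omega), hc (d + 1) (by omega), hc (d - 1) (by omega)]

theorem hasRun_oneRound (s : Memory) (m : ℕ) (h4 : s.nat 4 0 = m + 1)
    (hm : m < s.nat 1 0) (h1 : ∀ d, s.nat 1 0 + 2 ≤ d + (m + 1) → s.rat 1 d = 0)
    (h2 : ∀ d, s.nat 1 0 + 2 ≤ d → s.rat 2 d = 0) (S : ℕ)
    (hS : Nat.size (s.nat 3 0 - s.nat 2 m - 1) ≤ S) :
    HasRun oneRound s ((s.nat 1 0 + 2) * (50 * S + 200)) fun s' =>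
      (∀ a, a < 3 → s'.nat a = s.nat a) ∧ s'.nat 4 0 = m ∧ s'.nat 3 0 = s.nat 2 m ∧
        s'.rat 1 = roundVec (s.rat 1) (s.nat 3 0 - s.nat 2 m - 1) ∧
          ∀ d, s.nat 1 0 + 2 ≤ d → s'.rat 2 d = 0 := by
  set k := s.nat 1 0 with hk
  set x := s.nat 3 0 - s.nat 2 m - 1 with hx
  set s₁ := ((s.setNat 4 0 m).setNat 5 0 x).setNat 3 0 (s.nat 2 m) with hs₁
  have hvec : (fun d => if d < k + 2 then s.rat 1 d * (2 * (d : ℚ)) ^ x else 0) =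
      fun d => s.rat 1 d * (2 * (d : ℚ)) ^ x := by
    funext d
    split_ifs with h
    · rfl
    · rw [h1 d (by omega), zero_mul]
  have scale := hasRun_scaleProgram s₁ (by simpa [hs₁] using h2)
  have e1 : s₁.nat 1 0 = k := by simp [hs₁, hk]
  have e5 : s₁.nat 5 0 = x := by simp [hs₁]
  rw [e1, e5] at scale
  have tail : HasRun (.seq scaleProgram peakProgram) s₁
      (((k + 2) * (50 * Nat.size x + 80) + 20) + ((k + 2) * 80 + 20)) fun s' =>
        (∀ a, a < 3 → s'.nat a = s.nat a) ∧ s'.nat 4 0 = m ∧ s'.nat 3 0 = s.nat 2 m ∧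
        s'.rat 1 = roundVec (s.rat 1) x ∧ ∀ d, k + 2 ≤ d → s'.rat 2 d = 0 := by
    refine hasRun_seq (HasRun.mono scale le_rfl fun s₂ h => ?_)
    obtain ⟨hf, g1, g2⟩ := h
    have e1' : s₂.nat 1 0 = k := by rw [hf 1 (by decide) (by decide), e1]
    have peak := hasRun_peakProgram s₂
    rw [e1'] at peak
    refine HasRun.mono peak le_rfl fun s₃ h => ?_
    obtain ⟨hf', g1', g2'⟩ := h
    have r2 : s₂.rat 2 = fun d => s.rat 1 d * (2 * (d : ℚ)) ^ x := by
      rw [← hvec]; funext d; rw [g2]; simp [hs₁]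
    refine ⟨fun a ha => ?_, ?_, ?_, ?_, fun d hd => ?_⟩
    · rw [hf' a (by omega) (by omega), hf a (by omega) (by omega)]
      simp [hs₁, show a ≠ 3 by omega, show a ≠ 4 by omega, show a ≠ 5 by omega]
    · rw [hf' 4 (by decide) (by decide), hf 4 (by decide) (by decide)]
      simp [hs₁]
    · rw [hf' 3 (by decide) (by decide), hf 3 (by decide) (by decide)]
      simp [hs₁]
    · funext d
      rw [g2', r2]
      split_ifs with h
      · rfl
      · rw [g1, roundVec_eq_zero (N := k + 1 - m) (fun d hd => h1 d (by omega)) x d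
          (by omega)]
        simp only [hs₁, setNat_rat]
        exact h1 d (by omega)
    · rw [g1', g2, if_neg (by omega)]
  -- The 62 steps that do not grow with `k` are absorbed by the slack `40 * (k + 2)`, which is at
  -- least 80.
  have hT : 7 + (10 + (5 + (((k + 2) * (50 * Nat.size x + 80) + 20) + ((k + 2) * 80 + 20)))) ≤
      (k + 2) * (50 * S + 200) := by
    nlinarith [Nat.mul_le_mul_left (k + 2) hS]
  refine HasRun.mono (hasRun_seq (T₁ := 7) (HasRun.mono (hasRun_setNat (Q := fun s' => HasRun _ s' _ _)
    (hasRun_seq (T₁ := 10) (HasRun.mono (hasRun_setNat (Q := fun s' => HasRun _ s' _ _)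
      (hasRun_seq (T₁ := 5) (HasRun.mono (hasRun_setNat (Q := fun s' => HasRun _ s' _ _) ?_)
        ?_ fun _ h => h))) ?_ fun _ h => h))) ?_ fun _ h => h)) hT fun _ h => h
  · convert tail using 1
    simp [NatExpr.eval, h4, hs₁, hx]
  all_goals simp [NatExpr.cost]

/-! ### The coefficient vectors of a block -/

section CoefficientVectors

open Polynomial

/-- The coefficients of the generating polynomial of a block (for `i = 0`) with respect to the
powers of `1 + 2X`. -/
def blockVec : List Bool → ℕ → ℚ
  | [] => fun d => if d < 2 then 1 / 2 else 0
  | false :: B => fun d => blockVec B d * (2 * (d : ℚ))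
  | true :: B => peakVec (blockVec B)

/-- In the variable $u=1+2X$ the letter 0 acts as $2u\,d/du$, which is diagonal on powers of $u$.
Since $X=(u-1)/2$, the letter 1 acts as $\frac12(u^2-2u+1)\,d/du$, which is tridiagonal. The
starting polynomial $X+1$ is $(u+1)/2$. -/
theorem exists_poly_blockVec (B : List Bool) :
    ∃ q : ℚ[X], (∀ d, q.coeff d = blockVec B d) ∧
      blockOp B (emptyPoly 0) = q.comp (1 + C 2 * X) := by
  induction B with
  | nil =>
    refine ⟨C (1 / 2) * X + C (1 / 2), fun d => ?_, ?_⟩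
    · rcases d with _ | _ | d
      · simp [blockVec]
      · simp [blockVec, coeff_C]
      · simp [blockVec]
    · have h : (C (1 / 2) * C 2 : ℚ[X]) = 1 := by rw [← C_mul]; norm_num
      have h' : (C (1 / 2) + C (1 / 2) : ℚ[X]) = 1 := by rw [← C_add]; norm_num
      simp only [blockOp, LinearMap.id_apply, emptyPoly, if_true, add_comp, mul_comp, C_comp, X_comp,
        map_one, zero_add, pow_one]
      calc (X + 1 : ℚ[X]) = (C (1 / 2) * C 2) * X + (C (1 / 2) + C (1 / 2)) := by
            rw [h, h', one_mul]
        _ = _ := by ring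
  | cons e B ih =>
    obtain ⟨q, hq, hB⟩ := ih
    have hd : derivative (q.comp (1 + C 2 * X)) = C 2 * (derivative q).comp (1 + C 2 * X) := by
      rw [derivative_comp]; simp
    cases e
    · refine ⟨C 2 * (X * derivative q), fun d => ?_, ?_⟩
      · rcases d with _ | d
        · simp [blockVec]
        · rw [coeff_C_mul, coeff_X_mul, coeff_derivative, hq, blockVec]
          push_cast; ring
      · rw [blockOp, LinearMap.comp_apply, hB, letterOp_false, hd]
        simp only [mul_comp, C_comp, X_comp]
        ring
    · refine ⟨C (1 / 2) * (X ^ 2 * derivative q - C 2 * (X * derivative q) + derivative q),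
        fun d => ?_, ?_⟩
      · rw [coeff_C_mul, coeff_add, coeff_sub, coeff_C_mul, coeff_derivative, hq, blockVec, peakVec]
        rcases d with _ | _ | d
        · simp
          ring
        · simp [coeff_X_pow_mul', coeff_derivative, hq]
          ring
        · rw [coeff_X_pow_mul, coeff_X_mul, coeff_derivative, coeff_derivative, hq, hq]
          push_cast
          ring
      · have h : (C (1 / 2) * C 2 : ℚ[X]) = 1 := by rw [← C_mul]; norm_num
        have h2 : (C 2 * X : ℚ[X]) = (1 + C 2 * X) - 1 := by ring
        have h4 : (C 2 : ℚ[X]) = 2 := rfl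
        rw [blockOp, LinearMap.comp_apply, hB, letterOp_true, hd]
        simp only [mul_comp, C_comp, X_comp, add_comp, sub_comp, pow_comp]
        set D := (derivative q).comp (1 + C 2 * X)
        calc X ^ 2 * (C 2 * D) = (C (1 / 2) * C 2) * (X ^ 2 * (C 2 * D)) := by rw [h, one_mul]
          _ = _ := by rw [h4]; ring

/-- The constant coefficient is the value at $X=0$, where $u=1$, so the coefficients in powers of
$u$ are simply added. -/
theorem blockCount_eq_sum_blockVec (B : List Bool) (N : ℕ) (hN : ∀ d, N ≤ d → blockVec B d = 0) :
    (blockCount B 0 0 : ℚ) = ∑ d ∈ Finset.range N, blockVec B d := by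
  obtain ⟨q, hq, hB⟩ := exists_poly_blockVec B
  -- The bound is `N + 1` and not `N`, because for `N = 0` the zero polynomial still has `natDegree`
  -- 0; the additional term of the sum vanishes.
  have hdeg : q.natDegree < N + 1 := by
    refine Nat.lt_succ_of_le (natDegree_le_iff_coeff_eq_zero.2 fun d hd => ?_)
    rw [hq, hN d hd.le]
  rw [← coeff_blockOp, hB, coeff_zero_eq_eval_zero, eval_comp, eval_eq_sum_range' hdeg,
    Finset.sum_range_succ, hq N, hN N le_rfl]
  simp [hq]

end CoefficientVectors

theorem blockVec_replicate_false_append (x : ℕ) (B : List Bool) (d : ℕ) :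
    blockVec (List.replicate x false ++ B) d = blockVec B d * (2 * (d : ℚ)) ^ x := by
  induction x with
  | zero => simp
  | succ x ih =>
    rw [List.replicate_succ, List.cons_append, pow_succ, ← mul_assoc, ← ih]
    rfl

theorem getElem?_block (n : ℕ) (P : Finset ℕ) (t : ℕ) :
    (block n P)[t]? = if t < n then some (decide (t + 1 ∈ P)) else none := by
  split_ifs with h
  · simp [block, List.getElem?_range h]
  · simp [block, Nat.le_of_not_lt h]

theorem drop_block_eq_replicate_append {n a b : ℕ} {P : Finset ℕ} (hab : a ≤ b) (hb : b ≤ n)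
    (h : ∀ t, a < t → t ≤ b → t ∉ P) :
    (block n P).drop a = List.replicate (b - a) false ++ (block n P).drop b := by
  refine List.ext_getElem? fun t => ?_
  rw [List.getElem?_drop, getElem?_block]
  by_cases ht : t < b - a
  · rw [List.getElem?_append_left (by simpa using ht), List.getElem?_replicate, if_pos ht,
      if_pos (by omega)]
    simp [h (a + t + 1) (by omega) (by omega)]
  · rw [List.getElem?_append_right (by simpa using ht), List.length_replicate, List.getElem?_drop,
      getElem?_block, show b + (t - (b - a)) = a + t by omega]

theorem drop_block_eq_cons {n p : ℕ} {P : Finset ℕ} (hp : p ∈ P) (h1 : 1 ≤ p) (hn : p ≤ n) :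
    (block n P).drop (p - 1) = true :: (block n P).drop p := by
  refine List.ext_getElem? fun t => ?_
  rw [List.getElem?_drop, getElem?_block]
  rcases t with _ | t
  · simp [show p - 1 + 1 = p by omega, show p - 1 < n by omega, hp]
  · rw [List.getElem?_cons_succ, List.getElem?_drop, getElem?_block,
      show p - 1 + (t + 1) = p + t by omega]

/-- The sorted list of the elements of `P`, followed by `n + 1`. -/
def position (n : ℕ) (P : Finset ℕ) (m : ℕ) : ℕ :=
  if m < P.card then (P.sort (· ≤ ·)).getD m 0 else n + 1

section Position

variable {n : ℕ} {P : Finset ℕ} {m : ℕ}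

theorem position_eq_getElem (hm : m < P.card) :
    position n P m = (P.sort (· ≤ ·))[m]'(by rwa [Finset.length_sort]) := by
  rw [position, if_pos hm, List.getD_eq_getElem]

theorem position_mem (hm : m < P.card) : position n P m ∈ P := by
  rw [position_eq_getElem hm, ← Finset.mem_sort (· ≤ ·)]
  exact List.getElem_mem _

theorem position_lt_succ (hP : P ⊆ Finset.Icc 1 n) (hm : m < P.card) :
    position n P m < position n P (m + 1) := by
  by_cases h : m + 1 < P.card
  · rw [position_eq_getElem hm, position_eq_getElem h]
    exact (Finset.sortedLT_sort P).getElem_lt_getElem_of_lt (by omega)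
  · have := Finset.mem_Icc.1 (hP (position_mem (n := n) hm))
    rw [position.eq_def n P (m + 1), if_neg h]
    omega

theorem exists_position_eq {t : ℕ} (ht : t ∈ P) : ∃ m < P.card, position n P m = t := by
  rw [← Finset.mem_sort (· ≤ ·), List.mem_iff_getElem] at ht
  obtain ⟨m, hm, rfl⟩ := ht
  rw [Finset.length_sort] at hm
  exact ⟨m, hm, position_eq_getElem hm⟩

theorem position_le_of_le {l : ℕ} (hP : P ⊆ Finset.Icc 1 n) (hl : m ≤ P.card) (h : l ≤ m) :
    position n P l ≤ position n P m := by
  induction m, h using Nat.le_induction with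
  | base => exact le_rfl
  | succ m _ ih => exact (ih (by omega)).trans (position_lt_succ hP (by omega)).le

theorem position_bounds (hP : P ⊆ Finset.Icc 1 n) :
    1 ≤ position n P m ∧ position n P m ≤ n + 1 := by
  by_cases h : m < P.card
  · have := Finset.mem_Icc.1 (hP (position_mem (n := n) h))
    omega
  · rw [position, if_neg h]
    omega

theorem notMem_of_lt_position_succ (hP : P ⊆ Finset.Icc 1 n) (hm : m < P.card) {t : ℕ}
    (h₁ : position n P m < t) (h₂ : t < position n P (m + 1)) : t ∉ P := by
  intro ht
  obtain ⟨l, hl, rfl⟩ := exists_position_eq (n := n) ht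
  rcases Nat.lt_or_ge m l with h | h
  · exact absurd (position_le_of_le hP hl.le (show m + 1 ≤ l from h)) (by omega)
  · exact absurd (position_le_of_le hP hm.le h) (by omega)

theorem notMem_of_lt_position_zero (hP : P ⊆ Finset.Icc 1 n) {t : ℕ}
    (h₂ : t < position n P 0) : t ∉ P := by
  intro ht
  obtain ⟨l, hl, rfl⟩ := exists_position_eq (n := n) ht
  exact absurd (position_le_of_le hP hl.le (Nat.zero_le l)) (by omega)

/-- The suffix that starts at a one consists of this one, the zeros up to the next one, and the next
suffix. The sentinel `n + 1` in `position` makes the same count of zeros right for the last one of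
the block. -/
theorem blockVec_drop_position (hP : P ⊆ Finset.Icc 1 n) (hm : m < P.card) :
    blockVec ((block n P).drop (position n P m - 1)) =
      roundVec (blockVec ((block n P).drop (position n P (m + 1) - 1)))
        (position n P (m + 1) - position n P m - 1) := by
  have hb := Finset.mem_Icc.1 (hP (position_mem (n := n) hm))
  have hb' := position_bounds (m := m + 1) hP
  have hlt := position_lt_succ hP hm
  rw [drop_block_eq_cons (position_mem hm) hb.1 hb.2,
    drop_block_eq_replicate_append (b := position n P (m + 1) - 1) (by omega) (by omega)
      fun t h h' => notMem_of_lt_position_succ hP hm h (by omega), blockVec, roundVec]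
  congr 1
  funext d
  rw [blockVec_replicate_false_append, Nat.sub_right_comm]

theorem blockVec_block (hP : P ⊆ Finset.Icc 1 n) (d : ℕ) :
    blockVec (block n P) d =
      blockVec ((block n P).drop (position n P 0 - 1)) d *
        (2 * (d : ℚ)) ^ (position n P 0 - 1) := by
  have hb := position_bounds (m := 0) hP
  rw [← blockVec_replicate_false_append]
  have := drop_block_eq_replicate_append (n := n) (a := 0) (b := position n P 0 - 1) (P := P)
    (by omega) (by omega) fun t _ h' => notMem_of_lt_position_zero hP (by omega)
  rw [List.drop_zero, Nat.sub_zero] at this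
  rw [← this]

end Position

/-! ### Correctness of the main program -/

/-- The invariant of the main loop, when `m` ones remain. -/
def MainInvariant (n : ℕ) (P : Finset ℕ) (m : ℕ) (s : Memory) : Prop :=
  m ≤ P.card ∧ (∀ a, a < 3 → s.nat a = (input n P).nat a) ∧ s.nat 4 0 = m ∧
    s.nat 3 0 = position n P m ∧
      s.rat 1 = blockVec ((block n P).drop (position n P m - 1)) ∧
        (∀ d, P.card + 2 ≤ d + m → s.rat 1 d = 0) ∧ ∀ d, P.card + 2 ≤ d → s.rat 2 d = 0

theorem hasRun_oneRound_of_invariant {n : ℕ} {P : Finset ℕ} (hP : P ⊆ Finset.Icc 1 n) (m : ℕ)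
    (s : Memory) (h : MainInvariant n P (m + 1) s) :
    HasRun oneRound s ((P.card + 2) * (50 * Nat.size n + 200)) (MainInvariant n P m) := by
  obtain ⟨hm, hf, h4, h3, hv, hz, hz'⟩ := h
  have e1 : s.nat 1 0 = P.card := by rw [hf 1 (by decide)]; simp [input]
  have e2 : s.nat 2 m = position n P m := by
    rw [hf 2 (by decide), position, if_pos (by omega)]; simp [input]
  have hb := position_bounds (m := m + 1) hP
  have hS : Nat.size (s.nat 3 0 - s.nat 2 m - 1) ≤ Nat.size n :=
    Nat.size_le_size (by omega)
  have run := hasRun_oneRound s m h4 (by omega) (by rwa [e1]) (by rwa [e1]) _ hS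
  rw [e1] at run
  refine HasRun.mono run le_rfl fun s' h => ?_
  obtain ⟨g1, g2, g3, g4, g5⟩ := h
  refine ⟨by omega, fun a ha => (g1 a ha).trans (hf a ha), g2, g3.trans e2, ?_, fun d hd => ?_, g5⟩
  · rw [g4, h3, e2, hv]
    exact (blockVec_drop_position hP (by omega)).symm
  · rw [g4]
    exact roundVec_eq_zero (N := P.card + 1 - m) (fun d hd => hz d (by omega)) _ d (by omega)

theorem hasRun_mainProgram {n : ℕ} {P : Finset ℕ} (hP : P ⊆ Finset.Icc 1 n) :
    HasRun mainProgram (input n P) ((P.card + 1) * ((P.card + 2) * (50 * Nat.size n + 300)))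
      fun s => s.output = (blockCount (block n P) 0 0 : ℚ) := by
  set k := P.card with hk
  set s₀ := ((((input n P).setNat 3 0 (n + 1)).setNat 4 0 k).setRat 1 0 (1 / 2)).setRat 1 1 (1 / 2)
    with hs₀
  set T := (k + 2) * (50 * Nat.size n + 200) with hT
  have loop := hasRun_whileLt (e₁ := .const 0) (e₂ := natVar 4) (p := oneRound) (T := T)
    (MainInvariant n P)
    (fun m s h => ⟨by simp [h.2.2.1], hasRun_oneRound_of_invariant hP m s h⟩)
    -- Initially the suffix is empty, and the two cells 1/2 are its coefficients, from
    -- $X+1=(1+u)/2$.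
    (fun s h => by simp [h.2.2.1]) k s₀ (by
      have hpos : position n P k = n + 1 := by simp [position, hk]
      have hr : s₀.rat 1 = blockVec [] := by
        funext d
        rcases d with _ | _ | d <;> simp [hs₀, blockVec, input]
      refine ⟨le_rfl, fun a ha => ?_, ?_, ?_, ?_, fun d hd => ?_, fun d _ => ?_⟩
      · simp [hs₀, show a ≠ 3 by omega, show a ≠ 4 by omega]
      · simp [hs₀]
      · simp [hs₀, hpos]
      · rw [hr, hpos, Nat.add_sub_cancel, List.drop_of_length_le (by rw [length_block])]
      · rw [hr]
        exact if_neg (by omega)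
      · simp [hs₀, input])
  have tail : ∀ s, MainInvariant n P 0 s →
      HasRun (.seq (.setNat 5 (.const 0) (.sub (natVar 3) (.const 1))) sumProgram) s
        (6 + ((k + 2) * (50 * Nat.size n + 81) + 24))
        fun s => s.output = (blockCount (block n P) 0 0 : ℚ) := by
    rintro s ⟨-, hf, -, h3, hv, hz, -⟩
    set s₁ := s.setNat 5 0 (position n P 0 - 1) with hs₁
    have e1 : s₁.nat 1 0 = k := by
      simp [hs₁, hf 1 (by decide), input, hk]
    have e5 : s₁.nat 5 0 = position n P 0 - 1 := by simp [hs₁]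
    have hb := position_bounds (m := 0) hP
    have hS := Nat.mul_le_mul_left (k + 2) (add_le_add_left (Nat.mul_le_mul_left 50
      (Nat.size_le_size (show position n P 0 - 1 ≤ n by omega))) 81)
    have set5 : HasRun (.setNat 5 (.const 0) (.sub (natVar 3) (.const 1))) s 6 fun s' => s' = s₁ :=
      HasRun.mono (hasRun_setNat (Q := fun s' => s' = s₁) (by simp [hs₁, NatExpr.eval, h3]))
        (by simp [NatExpr.cost]) fun _ h => h
    refine hasRun_seq (HasRun.mono set5 le_rfl fun s' h => ?_)
    rw [h]
    have run := hasRun_sumProgram s₁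
    rw [e1, e5] at run
    refine HasRun.mono run (by omega) fun s' h => ?_
    rw [h, blockCount_eq_sum_blockVec (block n P) (k + 2)]
    · refine Finset.sum_congr rfl fun d _ => ?_
      rw [blockVec_block hP, ← hv]
      simp [hs₁]
    · intro d hd
      rw [blockVec_block hP, ← hv, hz d (by omega), zero_mul]
  have body : HasRun (.seq (.whileLt (.const 0) (natVar 4) oneRound)
      (.seq (.setNat 5 (.const 0) (.sub (natVar 3) (.const 1))) sumProgram)) s₀
        ((k * (T + 4) + 4) + (6 + ((k + 2) * (50 * Nat.size n + 81) + 24)))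
        fun s => s.output = (blockCount (block n P) 0 0 : ℚ) :=
    hasRun_seq (HasRun.mono loop (by simp) fun s h => tail s h)
  have hd : ∀ s : Memory, (RatExpr.div (.ofNat (.const 1)) (.ofNat (.const 2))).Defined s := by
    intro s; simp [RatExpr.Defined, RatExpr.eval]
  refine HasRun.mono (hasRun_seq (hasRun_setNat (hasRun_seq (hasRun_setNat
    (hasRun_seq (hasRun_setRat (hd _) (hasRun_seq (hasRun_setRat (hd _)
      (HasRun.mono body (le_refl _) fun _ h => h))))))))) ?_ fun _ h => h
  simp only [NatExpr.cost, RatExpr.cost, natVar_cost, hT]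
  nlinarith [Nat.zero_le (k * Nat.size n), Nat.zero_le (k * k)]

/-! ### From binary length to the logarithmic time bound -/

theorem size_le_log {n : ℕ} (hn : 1 ≤ n) : (Nat.size n : ℝ) ≤ 2 * Real.log n + 1 := by
  obtain ⟨m, hm⟩ : ∃ m, Nat.size n = m + 1 :=
    ⟨Nat.size n - 1, by have := Nat.size_pos.2 hn; omega⟩
  have h1 : 2 ^ m ≤ n := Nat.lt_size.1 (by omega)
  have h2 : (m : ℝ) * Real.log 2 ≤ Real.log n := by
    rw [← Real.log_pow]
    exact Real.log_le_log (by positivity) (by exact_mod_cast h1)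
  have h3 := Real.log_two_gt_d9
  have h4 : (m : ℝ) * (1 / 2) ≤ m * Real.log 2 :=
    mul_le_mul_of_nonneg_left (by linarith) (Nat.cast_nonneg m)
  rw [hm]
  push_cast
  linarith

theorem time_bound {n k t : ℕ} (hn : 1 ≤ n)
    (ht : t ≤ (k + 1) * ((k + 2) * (50 * Nat.size n + 300))) :
    (t : ℝ) ≤ 2100 * (((max k 1 : ℕ) : ℝ) ^ 2 * Real.log n + ((max k 1 : ℕ) : ℝ) ^ 4) := by
  set K := max k 1 with hK
  have h1 : t ≤ (2 * K) * ((3 * K) * (50 * Nat.size n + 300)) :=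
    ht.trans (Nat.mul_le_mul (by omega) (Nat.mul_le_mul_right _ (by omega)))
  have h2 : (t : ℝ) ≤ (2 * K) * ((3 * K) * (50 * Nat.size n + 300)) := by exact_mod_cast h1
  have h3 := size_le_log hn
  have hlog : 0 ≤ Real.log n := Real.log_natCast_nonneg n
  have hK1 : (1 : ℝ) ≤ K := by exact_mod_cast le_max_right k 1
  have hK2 : (1 : ℝ) ≤ (K : ℝ) ^ 2 := one_le_pow₀ hK1
  have h4 : (K : ℝ) ^ 2 ≤ (K : ℝ) ^ 4 := pow_le_pow_right₀ hK1 (by norm_num)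
  calc (t : ℝ) ≤ 6 * (K : ℝ) ^ 2 * (50 * Nat.size n + 300) := by linarith
    -- The additive constant also covers `n = 1`, where the logarithm vanishes. The constant 2100 is
    -- 6 · 350, and the term in $K^4$ is used only through $K^2\le K^4$.
    _ ≤ 6 * (K : ℝ) ^ 2 * (100 * Real.log n + 350) :=
        mul_le_mul_of_nonneg_left (by linarith) (by positivity)
    _ = 600 * ((K : ℝ) ^ 2 * Real.log n) + 2100 * (K : ℝ) ^ 2 := by ring
    _ ≤ 2100 * ((K : ℝ) ^ 2 * Real.log n) + 2100 * (K : ℝ) ^ 4 := by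
        have : 0 ≤ (K : ℝ) ^ 2 * Real.log n := by positivity
        linarith
    _ = _ := by ring

end Pinnacle

theorem mainTheorem5 :
    -- the numbers `p(B)^i_j` obey the two rules
    (Pinnacle.BlockRecursion (fun B i j => (Pinnacle.blockCount B i j : ℚ)) ∧
      Pinnacle.SegregatedFormula (fun B i j => (Pinnacle.blockCount B i j : ℚ))) ∧
    -- the two rules determine all of them
    (∀ F : List Bool → ℕ → ℕ → ℚ,
      Pinnacle.BlockRecursion F → Pinnacle.SegregatedFormula F →
      ∀ A : List Bool, A ≠ [] → ∀ i j : ℕ, F A i j = (Pinnacle.blockCount A i j : ℚ)) ∧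
    -- `p(A) = p(A)^0_0` is `|p_n(P)|` for the block `A` of any `P ⊆ [n]`
    (∀ (n : ℕ) (P : Finset ℕ), 1 ≤ n → P ⊆ Finset.Icc 1 n →
      Pinnacle.blockCount (Pinnacle.block n P) 0 0 = Pinnacle.pinnacleCount n P) ∧
    -- one program computes `p(A)` for all `n` and `P`, within the stated number of operations
    (∃ (prog : Pinnacle.Program) (C : ℝ), ∀ (n : ℕ) (P : Finset ℕ),
      1 ≤ n → P ⊆ Finset.Icc 1 n →
      ∃ (s : Pinnacle.Memory) (t : ℕ),
        Pinnacle.Runs prog (Pinnacle.input n P) s t ∧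
        s.output = (Pinnacle.blockCount (Pinnacle.block n P) 0 0 : ℚ) ∧
        (t : ℝ) ≤ C * (((max P.card 1 : ℕ) : ℝ) ^ 2 * Real.log n
          + ((max P.card 1 : ℕ) : ℝ) ^ 4)) := by

  refine ⟨⟨Pinnacle.blockRecursion_blockCount, Pinnacle.segregatedFormula_blockCount⟩,
    fun F hR hS A hA i j => Pinnacle.eq_blockCount_of_rules hR hS hA i j,
    fun n P _ hP => Pinnacle.blockCount_block hP,
    Pinnacle.mainProgram, 2100, fun n P hn hP => ?_⟩
  obtain ⟨s, t, hr, ht, hs⟩ := Pinnacle.hasRun_mainProgram hP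
  exact ⟨s, t, hr, hs, Pinnacle.time_bound hn ht⟩
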